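/- Let $N\ge 2$ be an integer and let $\beta>0$, $\lambda\ge 0$, $\mu\ge 0$ be real numbers. Put $g(v)=\sqrt{\beta/2\pi}\,e^{-\beta v^2/2}$ for $v\in\mathbb R$ and $\gamma(\mathbf v)=\prod_{j=1}^N g(v_j)$ for $\mathbf v\in\mathbb R^N$, and consider the real Hilbert space $L^2(\mathbb R^N,\gamma\,d\mathbf v)$ with inner product $\langle h_1,h_2\rangle=\int h_1h_2\,\gamma\,d\mathbf v$ and norm $\|h\|=\sqrt{\langle h,h\rangle}$. For $i<j$ let $\mathbf v_{i,j}(\theta)$ be obtained from $\mathbf v$ by replacing $v_i$ by $v_i\cos\theta+v_j\sin\theta$ and $v_j$ by $-v_i\sin\theta+v_j\cos\theta$, and let $\mathbf v_j(\theta,w)$ be obtained from $\mathbf v$ by replacing $v_j$ by $v_j\cos\theta+w\sin\theta$. Define $$Q[h](\mathbf v)=\frac1{\binom N2}\sum_{i<j}\frac1{2\pi}\int_0^{2\pi}h(\mathbf v_{i,j}(\theta))\,d\theta,\qquad T_j[h](\mathbf v)=\int_{\mathbb R}g(w)\,\frac1{2\pi}\int_0^{2\pi}h(\mathbf v_j(\theta,w))\,d\theta\,dw,$$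 $$\mathcal L h=\lambda N(I-Q)[h]+\mu\sum_{j=1}^N(I-T_j)[h].$$ Then $\mathcal L$ is a well-defined operator on $L^2(\mathbb R^N,\gamma\,d\mathbf v)$, and its spectral gap $$\Delta_N:=\inf\{\,|\langle h,\mathcal L h\rangle| : h\in L^2(\mathbb R^N,\gamma\,d\mathbf v),\ \|h\|=1,\ \langle h,1\rangle=0\,\}$$ satisfies $$\Delta_N=\frac{\mu}{2},$$ independently of $\lambda$ and $N$. The corresponding eigenfunction is $$h_{\Delta_N}(\mathbf v)=\sum_{i=1}^N\Bigl(v_i^2-\frac1\beta\Bigr):$$ it is a nonzero element of $L^2(\mathbb R^N,\gamma\,d\mathbf v)$ with $\langle h_{\Delta_N},1\rangle=0$ and $\mathcal L h_{\Delta_N}=\frac\mu2\,h_{\Delta_N}$; and if $\lambda>0$ and $\mu>0$, every eigenfunction of $\mathcal L$ in $L^2(\mathbb R^N,\gamma\,d\mathbf v)$ with eigenvalue $\mu/2$ is a scalar multiple of $h_{\Delta_N}$. -/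

import Mathlib

open MeasureTheory Real

noncomputable section

namespace KacThermostat

/-- The one-particle Maxwellian `g(v) = √(β/2π) exp(-β v²/2)` at inverse temperature `β`. -/
def maxwellian (β : ℝ) (v : ℝ) : ℝ := √(β / (2 * π)) * exp (-(β / 2) * v ^ 2)

/-- The equilibrium density `γ(v) = ∏ⱼ g(vⱼ)` on `ℝ^N`. -/
def gammaDensity (N : ℕ) (β : ℝ) (v : Fin N → ℝ) : ℝ := ∏ j, maxwellian β (v j)

/-- The measure `γ(v) dv` on `ℝ^N`. -/
def gammaMeasure (N : ℕ) (β : ℝ) : Measure (Fin N → ℝ) :=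
  volume.withDensity fun v => ENNReal.ofReal (gammaDensity N β v)

/-- The velocities after a collision of particles `i` and `j` with angle `θ`. -/
def pairCollision {N : ℕ} (i j : Fin N) (θ : ℝ) (v : Fin N → ℝ) : Fin N → ℝ :=
  Function.update (Function.update v i (v i * cos θ + v j * sin θ)) j
    (-v i * sin θ + v j * cos θ)

/-- The velocities after a collision of particle `j` with a thermostat particle of velocity `w`. -/
def bathCollision {N : ℕ} (j : Fin N) (θ w : ℝ) (v : Fin N → ℝ) : Fin N → ℝ :=
  Function.update v j (v j * cos θ + w * sin θ)

/-- The Kac collision average `Q`, an average over all pairs `i < j` and over the angle. -/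
def kacQ {N : ℕ} (h : (Fin N → ℝ) → ℝ) (v : Fin N → ℝ) : ℝ :=
  (1 / (N.choose 2 : ℝ)) *
    ∑ i : Fin N, ∑ j ∈ Finset.Ioi i, ⨍ θ in (0 : ℝ)..(2 * π), h (pairCollision i j θ v)

/-- The thermostat average `T_j`, acting on the particle `j`. -/
def bathT {N : ℕ} (β : ℝ) (j : Fin N) (h : (Fin N → ℝ) → ℝ) (v : Fin N → ℝ) : ℝ :=
  ∫ w : ℝ, maxwellian β w * ⨍ θ in (0 : ℝ)..(2 * π), h (bathCollision j θ w v)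

/-- The ground-state-transformed generator
`ℒ h = lam N (I - Q) h + μ ∑ⱼ (I - T_j) h`. -/
def generator {N : ℕ} (β lam μ : ℝ) (h : (Fin N → ℝ) → ℝ) (v : Fin N → ℝ) : ℝ :=
  lam * N * (h v - kacQ h v) + μ * ∑ j : Fin N, (h v - bathT β j h v)

/-- The inner product `⟨h₁, h₂⟩ = ∫ h₁ h₂ γ dv` of `L²(ℝ^N, γ dv)`. -/
def gammaInner {N : ℕ} (β : ℝ) (h₁ h₂ : (Fin N → ℝ) → ℝ) : ℝ :=
  ∫ v, h₁ v * h₂ v ∂(gammaMeasure N β)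

/-- The norm of `L²(ℝ^N, γ dv)`. -/
def gammaNorm {N : ℕ} (β : ℝ) (h : (Fin N → ℝ) → ℝ) : ℝ := √(gammaInner β h h)

/-- The spectral gap
`Δ_N = inf { |⟨h, ℒ h⟩| : h ∈ L²(ℝ^N, γ dv), ‖h‖ = 1, ⟨h, 1⟩ = 0 }`. -/
def spectralGap (N : ℕ) (β lam μ : ℝ) : ℝ :=
  sInf { r : ℝ | ∃ h : (Fin N → ℝ) → ℝ, MemLp h 2 (gammaMeasure N β) ∧
    gammaNorm β h = 1 ∧ gammaInner β h (fun _ => 1) = 0 ∧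
    r = |gammaInner β h (generator β lam μ h)| }

/-- `h` is (a representative of) an eigenfunction of `ℒ` on `L²(ℝ^N, γ dv)` with
eigenvalue `E`. -/
def IsEigenfunction {N : ℕ} (β lam μ E : ℝ) (h : (Fin N → ℝ) → ℝ) : Prop :=
  MemLp h 2 (gammaMeasure N β) ∧ ¬ (h =ᵐ[gammaMeasure N β] 0) ∧
    generator β lam μ h =ᵐ[gammaMeasure N β] fun v => E * h v

/-- The function `∑ᵢ (vᵢ² - 1/β)`. -/
def gapFunction (N : ℕ) (β : ℝ) (v : Fin N → ℝ) : ℝ := ∑ i : Fin N, ((v i) ^ 2 - 1 / β)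

end KacThermostat

end

noncomputable section

namespace KacThermostat

open ProbabilityTheory

/-! The two parts of the generator are treated separately, and the gap comes from the thermostat
alone. A pair collision is a rotation, so it preserves `γ`. A bath collision is a rotation of the
pair `(v_j, w)` after which `w` is forgotten, so it carries `γ ⊗ g` to `γ`. Averaging over maps of
this kind is a contraction (`integral_mul_average_self_le`), hence `⟨h, (I - Q) h⟩ ≥ 0`, and `lam`
can only raise the quadratic form.

The bath part is diagonal in the products `H_α` of Hermite functions. Mehler's identity gives `T_j
H_α = c_{α_j} H_α`, where `c_n` is the mean of `cosⁿ` over a period. Here `c_0 = 1`, `c_1 = 0`, `c_2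
= 1/2`, and `c_n < 1/2` for `n ≥ 3`. So the eigenvalue `∑ⱼ (1 - c_{α_j})` is at least `1/2` for
every `α ≠ 0`, with equality exactly when `α` has one nonzero entry and this entry is `2`. The `H_α`
are complete, because a square integrable function orthogonal to all of them has vanishing Fourier
transform. By Parseval, `⟨h, ∑ⱼ (I - T_j) h⟩ - ‖h‖²/2` is then a series of nonnegative terms as soon
as `h` has mean zero. This proves the lower bound `μ/2`. It is attained at `∑ᵢ (vᵢ² - 1/β)`, which
every rotation fixes.

For uniqueness, an eigenfunction for `μ/2` makes both nonnegative defects vanish. The bath defect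
forces `h = ∑ⱼ cⱼ (vⱼ² - 1/β)`. For such `h`, the defect of `Q` is the average over pairs of `(cᵢ -
cⱼ)²/β²`, so all `cⱼ` agree. -/

theorem integral_comp_measurePreserving {X Y : Type*} [MeasurableSpace X] [MeasurableSpace Y]
    {P : Measure X} {ρ : Measure Y} {φ : X → Y} (hφ : MeasurePreserving φ P ρ) {f : Y → ℝ}
    (hf : AEStronglyMeasurable f ρ) : ∫ x, f (φ x) ∂P = ∫ y, f y ∂ρ := by
  rw [← hφ.map_eq] at hf ⊢
  exact (integral_map hφ.aemeasurable hf).symm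

/-! ### Averages over measure preserving collisions -/

section Averaging

variable {X Ω : Type*} [MeasurableSpace X] [MeasurableSpace Ω] {γ : Measure X} {ν : Measure Ω}
  {Φ : X × Ω → X}

/-- On almost every fibre, nonnegativity of the variance bounds the squared mean by the mean square,
which is integrable by Fubini. -/
theorem memLp_two_integral_prod [IsProbabilityMeasure γ] [IsProbabilityMeasure ν]
    {f : X × Ω → ℝ} (hf : MemLp f 2 (γ.prod ν)) :
    MemLp (fun x => ∫ y, f (x, y) ∂ν) 2 γ := by
  have hsq : Integrable (fun p => f p ^ 2) (γ.prod ν) := hf.integrable_sq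
  have hm : AEStronglyMeasurable (fun x => ∫ y, f (x, y) ∂ν) γ := hf.1.integral_prod_right'
  rw [memLp_two_iff_integrable_sq hm]
  refine Integrable.mono' hsq.integral_prod_left (hm.pow 2) ?_
  filter_upwards [hsq.prod_right_ae, hf.1.prodMk_left] with x hx hx'
  have hL : MemLp (fun y => f (x, y)) 2 ν := (memLp_two_iff_integrable_sq hx').2 hx
  have hv := ProbabilityTheory.variance_eq_sub hL
  have h0 := ProbabilityTheory.variance_nonneg (fun y => f (x, y)) ν
  rw [Real.norm_eq_abs, abs_of_nonneg (sq_nonneg _)]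
  simp only [Pi.pow_apply] at hv
  linarith

theorem memLp_average [IsProbabilityMeasure γ] [IsProbabilityMeasure ν]
    (hΦ : MeasurePreserving Φ (γ.prod ν) γ) {h : X → ℝ} (hh : MemLp h 2 γ) :
    MemLp (fun x => ∫ y, h (Φ (x, y)) ∂ν) 2 γ :=
  memLp_two_integral_prod (f := fun p => h (Φ p)) (hh.comp_measurePreserving hΦ)

/-- The preimage of a null set under `Φ` is null in the product, so almost every fibre of it is
null. This is what makes the collision averages well defined on `L²` classes. -/
theorem average_congr_ae [SFinite ν] (hΦ : MeasurePreserving Φ (γ.prod ν) γ) {h k : X → ℝ}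
    (hk : h =ᵐ[γ] k) :
    (fun x => ∫ y, h (Φ (x, y)) ∂ν) =ᵐ[γ] fun x => ∫ y, k (Φ (x, y)) ∂ν := by
  have h1 : ∀ᵐ p ∂(γ.prod ν), h (Φ p) = k (Φ p) := hΦ.quasiMeasurePreserving.ae hk
  filter_upwards [Measure.ae_ae_of_ae_prod h1] with x hx
  exact integral_congr_ae hx

theorem integrable_mul_comp [IsProbabilityMeasure γ] [IsProbabilityMeasure ν]
    (hΦ : MeasurePreserving Φ (γ.prod ν) γ) {h k : X → ℝ} (hh : MemLp h 2 γ) (hk : MemLp k 2 γ) :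
    Integrable (fun p : X × Ω => k p.1 * h (Φ p)) (γ.prod ν) :=
  (hk.comp_measurePreserving measurePreserving_fst).integrable_mul
    (hh.comp_measurePreserving hΦ)

theorem integral_mul_average [IsProbabilityMeasure γ] [IsProbabilityMeasure ν]
    (hΦ : MeasurePreserving Φ (γ.prod ν) γ) {h k : X → ℝ} (hh : MemLp h 2 γ) (hk : MemLp k 2 γ) :
    ∫ x, k x * ∫ y, h (Φ (x, y)) ∂ν ∂γ = ∫ p, k p.1 * h (Φ p) ∂(γ.prod ν) := by
  rw [integral_prod _ (integrable_mul_comp hΦ hh hk)]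
  simp only [integral_const_mul]

theorem integral_average [IsProbabilityMeasure γ] [IsProbabilityMeasure ν]
    (hΦ : MeasurePreserving Φ (γ.prod ν) γ) {h : X → ℝ} (hh : MemLp h 2 γ) :
    ∫ x, ∫ y, h (Φ (x, y)) ∂ν ∂γ = ∫ x, h x ∂γ := by
  have h1 := integral_mul_average hΦ hh (memLp_const (1 : ℝ))
  simp only [one_mul] at h1
  rw [h1, integral_comp_measurePreserving hΦ hh.1]

/-- From `ab ≤ (a² + b²)/2`, since both squares have the same integral by invariance. No
self-adjointness of the average is needed. -/
theorem integral_mul_average_self_le [IsProbabilityMeasure γ] [IsProbabilityMeasure ν]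
    (hΦ : MeasurePreserving Φ (γ.prod ν) γ) {h : X → ℝ} (hh : MemLp h 2 γ) :
    ∫ x, h x * ∫ y, h (Φ (x, y)) ∂ν ∂γ ≤ ∫ x, h x * h x ∂γ := by
  rw [integral_mul_average hΦ hh hh]
  have hsq : Integrable (fun x => h x * h x) γ := hh.integrable_mul hh
  have h1 : Integrable (fun p : X × Ω => h p.1 * h p.1) (γ.prod ν) :=
    measurePreserving_fst.integrable_comp_of_integrable hsq
  have h2 : Integrable (fun p : X × Ω => h (Φ p) * h (Φ p)) (γ.prod ν) :=
    hΦ.integrable_comp_of_integrable hsq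
  have e1 : ∫ p : X × Ω, h p.1 * h p.1 ∂(γ.prod ν) = ∫ x, h x * h x ∂γ := by
    rw [integral_prod _ h1]; simp
  have e2 : ∫ p : X × Ω, h (Φ p) * h (Φ p) ∂(γ.prod ν) = ∫ x, h x * h x ∂γ :=
    integral_comp_measurePreserving hΦ hsq.1
  calc ∫ p, h p.1 * h (Φ p) ∂(γ.prod ν)
      ≤ ∫ p, (1 / 2) * (h p.1 * h p.1 + h (Φ p) * h (Φ p)) ∂(γ.prod ν) := by
        refine integral_mono (integrable_mul_comp hΦ hh hh) ((h1.add h2).const_mul _) fun p => ?_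
        nlinarith [sq_nonneg (h p.1 - h (Φ p))]
    _ = ∫ x, h x * h x ∂γ := by
        rw [integral_const_mul, integral_add h1 h2, e1, e2]; ring

/-- A measurable family of measure preserving maps is jointly measure preserving. -/
theorem measurePreserving_uncurry [SFinite γ] [IsProbabilityMeasure ν] {Y : Type*}
    [MeasurableSpace Y] {ρ : Measure Y} [SFinite ρ] {F : Ω → X → Y}
    (hF : Measurable (Function.uncurry F)) (hp : ∀ ω, MeasurePreserving (F ω) γ ρ) :
    MeasurePreserving (fun p : X × Ω => F p.2 p.1) (γ.prod ν) ρ := by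
  have h1 : MeasurePreserving (fun p : Ω × X => (p.1, F p.1 p.2)) (ν.prod γ) (ν.prod ρ) :=
    (MeasurePreserving.id ν).skew_product hF (Filter.Eventually.of_forall fun ω => (hp ω).map_eq)
  exact (measurePreserving_snd (μ := ν)).comp (h1.comp Measure.measurePreserving_swap)

end Averaging

/-! ### The Gaussian measure and the angular measure -/

/-- The one-particle Maxwellian measure `g(v) dv`. -/
def oneMeasure (β : ℝ) : Measure ℝ := gaussianReal 0 β⁻¹.toNNReal

instance (β : ℝ) : IsProbabilityMeasure (oneMeasure β) := by
  unfold oneMeasure; infer_instance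

theorem maxwellian_eq_gaussianPDFReal {β : ℝ} (hβ : 0 < β) :
    maxwellian β = gaussianPDFReal 0 β⁻¹.toNNReal := by
  funext v
  have h : ((β⁻¹.toNNReal : NNReal) : ℝ) = β⁻¹ := Real.coe_toNNReal _ (inv_pos.2 hβ).le
  rw [maxwellian, gaussianPDFReal, h, ← Real.sqrt_inv]
  congr 2
  · field_simp
  · field_simp
    ring

theorem toNNReal_inv_ne_zero {β : ℝ} (hβ : 0 < β) : β⁻¹.toNNReal ≠ 0 := by
  simpa using hβ

theorem oneMeasure_eq_withDensity {β : ℝ} (hβ : 0 < β) :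
    oneMeasure β = volume.withDensity fun v => ENNReal.ofReal (maxwellian β v) := by
  rw [oneMeasure, gaussianReal_of_var_ne_zero _ (toNNReal_inv_ne_zero hβ),
    maxwellian_eq_gaussianPDFReal hβ]
  rfl

theorem maxwellian_nonneg (β v : ℝ) : 0 ≤ maxwellian β v := by
  unfold maxwellian; positivity

theorem integral_maxwellian_mul {β : ℝ} (hβ : 0 < β) (F : ℝ → ℝ) :
    ∫ w, maxwellian β w * F w = ∫ w, F w ∂(oneMeasure β) := by
  rw [oneMeasure, integral_gaussianReal_eq_integral_smul (toNNReal_inv_ne_zero hβ),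
    maxwellian_eq_gaussianPDFReal hβ]
  simp only [smul_eq_mul]

/-- The analysis below is done on the product of one-particle Gaussians; this identity, checked on
boxes, carries it over to the density `γ`. -/
theorem gammaMeasure_eq_pi (N : ℕ) {β : ℝ} (hβ : 0 < β) :
    gammaMeasure N β = Measure.pi fun _ => oneMeasure β := by
  have hint : Integrable (maxwellian β) := by
    rw [maxwellian_eq_gaussianPDFReal hβ]; exact integrable_gaussianPDFReal _ _
  refine (Measure.pi_eq fun s hs => ?_).symm
  rw [gammaMeasure, withDensity_apply _ (MeasurableSet.univ_pi hs), volume_pi,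
    Measure.restrict_pi_pi]
  unfold gammaDensity
  rw [← ofReal_integral_eq_lintegral_ofReal
    (Integrable.fintype_prod fun i => hint.restrict (s := s i))
    (Filter.Eventually.of_forall fun v => Finset.prod_nonneg fun i _ => maxwellian_nonneg _ _),
    integral_fintype_prod_eq_prod (f := fun _ => maxwellian β),
    ENNReal.ofReal_prod_of_nonneg
      fun i _ => integral_nonneg fun v => maxwellian_nonneg _ _]
  refine Finset.prod_congr rfl fun i _ => ?_
  rw [oneMeasure_eq_withDensity hβ, withDensity_apply _ (hs i),
    ofReal_integral_eq_lintegral_ofReal hint.restrict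
    (Filter.Eventually.of_forall fun v => maxwellian_nonneg _ _)]

/-- The uniform probability measure on the angles. -/
def angleMeasure : Measure ℝ :=
  (volume.restrict (Set.uIoc 0 (2 * π)) Set.univ)⁻¹ • volume.restrict (Set.uIoc 0 (2 * π))

instance : IsProbabilityMeasure angleMeasure := by
  constructor
  have : (0 : ℝ) < 2 * π := by positivity
  simp only [angleMeasure, Measure.smul_apply, Measure.restrict_apply_univ, smul_eq_mul]
  rw [Set.uIoc_of_le this.le, Real.volume_Ioc]
  refine ENNReal.inv_mul_cancel ?_ ENNReal.ofReal_ne_top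
  simpa using this

/-- Definitional, because `angleMeasure` is exactly the normalized restriction to which the averaged
integral unfolds. -/
theorem interval_average_eq_angleMeasure (f : ℝ → ℝ) :
    (⨍ θ in (0 : ℝ)..(2 * π), f θ) = ∫ θ, f θ ∂angleMeasure := rfl

/-! ### Collisions as rotations of the Gaussian measure -/

variable {N : ℕ}

/-- The collision of the particles `i` and `j` as a linear map. -/
def pairCollisionL (i j : Fin N) (θ : ℝ) : (Fin N → ℝ) →L[ℝ] (Fin N → ℝ) :=
  LinearMap.toContinuousLinearMap
    { toFun := pairCollision i j θ
      map_add' := fun v w => by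
        funext k
        simp only [pairCollision, Function.update_apply, Pi.add_apply]
        split_ifs <;> ring
      map_smul' := fun c v => by
        funext k
        simp only [pairCollision, Function.update_apply, Pi.smul_apply, smul_eq_mul,
          RingHom.id_apply]
        split_ifs <;> ring }

theorem pairCollisionL_apply (i j : Fin N) (θ : ℝ) (v : Fin N → ℝ) :
    pairCollisionL i j θ v = pairCollision i j θ v := rfl

/-- The characteristic function sees `L` only through the sum of the squares of its coefficients;
rotation invariance rests on this. -/
theorem charFunDual_pi_oneMeasure {β : ℝ} (L : StrongDual ℝ (Fin N → ℝ)) :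
    charFunDual (Measure.pi fun _ : Fin N => oneMeasure β) L
      = Complex.exp (-(((β⁻¹.toNNReal : ℝ) * ∑ k, L (Pi.single k 1) ^ 2 / 2 : ℝ) : ℂ)) := by
  rw [charFunDual_pi]
  have h : ∀ k, charFunDual (oneMeasure β) (L.comp (.single ℝ (fun _ => ℝ) k))
      = Complex.exp (-(((β⁻¹.toNNReal : ℝ) * (L (Pi.single k 1) ^ 2 / 2) : ℝ) : ℂ)) := by
    intro k
    have hL : ∀ x : ℝ, L.comp (ContinuousLinearMap.single ℝ (fun _ => ℝ) k) x
        = L (Pi.single k 1) * x := by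
      intro x
      have : (Pi.single k x : Fin N → ℝ) = x • Pi.single k 1 := by
        rw [← Pi.single_smul]; simp
      simp only [ContinuousLinearMap.comp_apply, ContinuousLinearMap.single_apply]
      rw [this, map_smul, smul_eq_mul, mul_comm]
    rw [charFunDual_apply]
    simp_rw [hL]
    have := charFun_gaussianReal (μ := 0) (v := β⁻¹.toNNReal) (L (Pi.single k 1))
    rw [charFun_apply_real] at this
    simp only [Complex.ofReal_mul]
    rw [oneMeasure, this]
    push_cast
    congr 1
    ring
  rw [Finset.prod_congr rfl fun k _ => h k, ← Complex.exp_sum]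
  congr 1
  push_cast
  rw [Finset.mul_sum, Finset.sum_neg_distrib]

theorem measurePreserving_pairCollision {β : ℝ} {i j : Fin N} (hij : i ≠ j) (θ : ℝ) :
    MeasurePreserving (pairCollision i j θ) (Measure.pi fun _ : Fin N => oneMeasure β)
      (Measure.pi fun _ => oneMeasure β) := by
  have hm : Measurable (pairCollision i j θ) := (pairCollisionL i j θ).continuous.measurable
  refine ⟨hm, ?_⟩
  have : IsProbabilityMeasure (Measure.map (pairCollision i j θ)
      (Measure.pi fun _ : Fin N => oneMeasure β)) :=
    Measure.isProbabilityMeasure_map hm.aemeasurable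
  refine Measure.ext_of_charFunDual (funext fun L => ?_)
  have h1 : charFunDual (Measure.map (pairCollision i j θ)
      (Measure.pi fun _ : Fin N => oneMeasure β)) L
      = charFunDual (Measure.pi fun _ : Fin N => oneMeasure β) (L.comp (pairCollisionL i j θ)) := by
    rw [charFunDual_apply, charFunDual_apply, integral_map hm.aemeasurable]
    · rfl
    · exact (by fun_prop : Continuous fun v : Fin N → ℝ =>
        Complex.exp ((L v : ℂ) * Complex.I)).aestronglyMeasurable
  rw [h1, charFunDual_pi_oneMeasure, charFunDual_pi_oneMeasure]
  have e1 : pairCollision i j θ (Pi.single i 1)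
      = cos θ • (Pi.single i 1 : Fin N → ℝ) - sin θ • Pi.single j 1 := by
    funext k
    simp only [pairCollision, Function.update_apply, Pi.sub_apply, Pi.smul_apply, Pi.single_apply,
      smul_eq_mul]
    split_ifs <;> simp_all
  have e2 : pairCollision i j θ (Pi.single j 1)
      = sin θ • (Pi.single i 1 : Fin N → ℝ) + cos θ • Pi.single j 1 := by
    funext k
    simp only [pairCollision, Function.update_apply, Pi.add_apply, Pi.smul_apply, Pi.single_apply,
      smul_eq_mul]
    split_ifs <;> simp_all
  have e3 : ∀ k, k ≠ i → k ≠ j → pairCollision i j θ (Pi.single k 1) = Pi.single k 1 := by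
    intro k hki hkj
    funext l
    simp only [pairCollision, Function.update_apply, Pi.single_apply]
    split_ifs <;> simp_all
  -- Only the coefficients `a`, `b` at `i`, `j` change, and `(a cos θ - b sin θ)² + (a sin θ + b cos
  -- θ)² = a² + b²`.
  have h2 : ∑ k, ((L.comp (pairCollisionL i j θ)) (Pi.single k 1) ^ 2
      - L (Pi.single k 1) ^ 2) = 0 := by
    rw [Fintype.sum_eq_add i j hij]
    · simp only [ContinuousLinearMap.comp_apply, pairCollisionL_apply, e1, e2, map_sub, map_add,
        map_smul, smul_eq_mul]
      linear_combination (L (Pi.single i 1) ^ 2 + L (Pi.single j 1) ^ 2) * sin_sq_add_cos_sq θ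
    · rintro k ⟨hki, hkj⟩
      simp only [ContinuousLinearMap.comp_apply, pairCollisionL_apply, e3 k hki hkj, sub_self]
  rw [Finset.sum_sub_distrib, sub_eq_zero] at h2
  simp only [← Finset.sum_div, h2]

theorem measurable_pairCollision (i j : Fin N) :
    Measurable (Function.uncurry (pairCollision i j)) := by
  refine measurable_pi_lambda _ fun k => ?_
  simp only [Function.uncurry, pairCollision, Function.update_apply]
  split_ifs <;> fun_prop

/-- With the bath particle adjoined as particle `0`, a bath collision becomes a rotation in `N + 1`
variables followed by a projection, and so inherits the invariance of rotations. -/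
theorem bathCollision_eq_pairCollision (j : Fin N) (θ w : ℝ) (v : Fin N → ℝ) :
    bathCollision j θ w v
      = fun k => pairCollision j.succ 0 θ (Fin.cons w v : Fin (N + 1) → ℝ) k.succ := by
  funext k
  simp only [bathCollision, pairCollision, Function.update_apply, Fin.succ_ne_zero, if_false,
    Fin.succ_inj, Fin.cons_succ, Fin.cons_zero]

/-- Adjoining the bath velocity as an additional particle. -/
theorem measurePreserving_cons (β : ℝ) :
    MeasurePreserving (fun p : (Fin N → ℝ) × ℝ => (Fin.cons p.2 p.1 : Fin (N + 1) → ℝ))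
      ((Measure.pi fun _ => oneMeasure β).prod (oneMeasure β))
      (Measure.pi fun _ => oneMeasure β) := by
  have h := (measurePreserving_piFinSuccAbove (fun _ : Fin (N + 1) => oneMeasure β) 0).symm
  have h2 := h.comp Measure.measurePreserving_swap
  convert h2 using 1
  funext p
  simp [MeasurableEquiv.piFinSuccAbove_symm_apply, Fin.insertNthEquiv]

theorem measurePreserving_tail (β : ℝ) :
    MeasurePreserving (fun (V : Fin (N + 1) → ℝ) (k : Fin N) => V k.succ)
      (Measure.pi fun _ => oneMeasure β) (Measure.pi fun _ => oneMeasure β) := by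
  have h := measurePreserving_piFinSuccAbove (fun _ : Fin (N + 1) => oneMeasure β) 0
  have h2 := (measurePreserving_snd (μ := oneMeasure β)
    (ν := Measure.pi fun _ : Fin N => oneMeasure β)).comp h
  exact h2

theorem measurePreserving_bathCollision (β : ℝ) (j : Fin N) (θ : ℝ) :
    MeasurePreserving (fun p : (Fin N → ℝ) × ℝ => bathCollision j θ p.2 p.1)
      ((Measure.pi fun _ => oneMeasure β).prod (oneMeasure β))
      (Measure.pi fun _ => oneMeasure β) := by
  have h := (measurePreserving_tail β).comp
    ((measurePreserving_pairCollision (β := β) (Fin.succ_ne_zero j) θ).comp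
      (measurePreserving_cons β))
  convert h using 1
  funext p
  rw [bathCollision_eq_pairCollision]
  rfl

theorem pairCollision_neg_pairCollision {i j : Fin N} (hij : i ≠ j) (θ : ℝ) (v : Fin N → ℝ) :
    pairCollision i j (-θ) (pairCollision i j θ v) = v := by
  funext k
  simp only [pairCollision, Function.update_apply, cos_neg, sin_neg]
  split_ifs with h1 h2
  · subst h1
    linear_combination v k * sin_sq_add_cos_sq θ
  · subst h2
    linear_combination v k * sin_sq_add_cos_sq θ
  · rfl

/-- The transfer of a collision with angle `θ` from one factor to the other. -/
theorem integral_mul_bathCollision (β : ℝ) (j : Fin N) (θ : ℝ) {h k : (Fin N → ℝ) → ℝ}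
    (hh : AEStronglyMeasurable h (Measure.pi fun _ : Fin N => oneMeasure β))
    (hk : AEStronglyMeasurable k (Measure.pi fun _ : Fin N => oneMeasure β)) :
    ∫ p : (Fin N → ℝ) × ℝ, k p.1 * h (bathCollision j θ p.2 p.1)
        ∂((Measure.pi fun _ => oneMeasure β).prod (oneMeasure β))
      = ∫ p : (Fin N → ℝ) × ℝ, k (bathCollision j (-θ) p.2 p.1) * h p.1
        ∂((Measure.pi fun _ => oneMeasure β).prod (oneMeasure β)) := by
  have hc := measurePreserving_cons (N := N) β
  have hr := measurePreserving_pairCollision (β := β) (Fin.succ_ne_zero j) θ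
  have hr' := measurePreserving_pairCollision (β := β) (Fin.succ_ne_zero j) (-θ)
  have ht := measurePreserving_tail (N := N) β
  let τ : (Fin (N + 1) → ℝ) → (Fin N → ℝ) := fun V k => V k.succ
  have hF := (hk.comp_measurePreserving ht).mul (hh.comp_measurePreserving (ht.comp hr))
  have hG := (hk.comp_measurePreserving (ht.comp hr')).mul (hh.comp_measurePreserving ht)
  -- On `N` particles a bath collision with fixed `w` need not be invertible or preserve `γ`. On `N
  -- + 1` particles it is a rotation, and its inverse moves it onto the other factor.
  calc _ = ∫ V, k (τ V) * h (τ (pairCollision j.succ 0 θ V))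
          ∂(Measure.pi fun _ => oneMeasure β) := by
        refine Eq.trans ?_ (integral_comp_measurePreserving hc hF)
        simp [bathCollision_eq_pairCollision, τ]
    _ = ∫ V, k (τ (pairCollision j.succ 0 (-θ) V)) * h (τ V)
          ∂(Measure.pi fun _ => oneMeasure β) := by
        refine Eq.trans ?_ (integral_comp_measurePreserving hr hG)
        simp [pairCollision_neg_pairCollision (Fin.succ_ne_zero j), τ]
    _ = _ := by
        refine Eq.trans (integral_comp_measurePreserving hc hG).symm ?_
        simp [bathCollision_eq_pairCollision]

theorem measurable_bathCollision (j : Fin N) :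
    Measurable (fun p : ℝ × ((Fin N → ℝ) × ℝ) => bathCollision j p.1 p.2.2 p.2.1) := by
  refine measurable_pi_lambda _ fun k => ?_
  simp only [bathCollision, Function.update_apply]
  split_ifs <;> fun_prop

/-! ### Hermite polynomials and the standard Gaussian -/

section HermitePolynomials

open Polynomial

/-- The probabilists' Hermite polynomials over `ℝ`. -/
def hermiteR (n : ℕ) : ℝ[X] := (Polynomial.hermite n).map (Int.castRingHom ℝ)

theorem hermiteR_zero : hermiteR 0 = 1 := by simp [hermiteR]

theorem hermiteR_succ (n : ℕ) :
    hermiteR (n + 1) = X * hermiteR n - derivative (hermiteR n) := by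
  simp [hermiteR, Polynomial.hermite_succ, Polynomial.derivative_map]

theorem hermiteR_one : hermiteR 1 = X := by simp [hermiteR]

theorem derivative_hermiteR_succ (n : ℕ) :
    derivative (hermiteR (n + 1)) = ((n : ℝ[X]) + 1) * hermiteR n := by
  induction n with
  | zero => simp [hermiteR_one, hermiteR_zero]
  | succ n ih =>
    rw [hermiteR_succ (n + 1), derivative_sub, derivative_mul, ih, derivative_mul,
      derivative_X, hermiteR_succ n]
    simp only [derivative_add, derivative_one, derivative_natCast]
    push_cast
    ring

theorem integrable_eval_gaussian (P : ℝ[X]) :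
    Integrable (fun x => P.eval x) (gaussianReal 0 1) := by
  induction P using Polynomial.induction_on' with
  | add p q hp hq => simp only [eval_add]; exact hp.add hq
  | monomial n a =>
    simp only [eval_monomial]
    refine Integrable.const_mul ?_ a
    have h1 := integrable_exp_mul_gaussianReal (μ := 0) (v := 1) 1
    have h2 := integrable_exp_mul_gaussianReal (μ := 0) (v := 1) (-1)
    exact integrable_pow_of_integrable_exp_mul (X := fun x => x) one_ne_zero h1 h2 n

theorem integrable_eval_mul_gaussianPDFReal (P : ℝ[X]) :
    Integrable (fun x => P.eval x * gaussianPDFReal 0 1 x) := by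
  have h := integrable_eval_gaussian P
  rw [gaussianReal_of_var_ne_zero _ one_ne_zero] at h
  rw [integrable_withDensity_iff_integrable_smul' (measurable_gaussianPDF _ _)
    (Filter.Eventually.of_forall fun _ => gaussianPDF_lt_top)] at h
  simpa [toReal_gaussianPDF, mul_comm] using h

theorem hasDerivAt_gaussianPDFReal (x : ℝ) :
    HasDerivAt (gaussianPDFReal 0 1) (-x * gaussianPDFReal 0 1 x) x := by
  have h : HasDerivAt (fun x : ℝ => (√(2 * π * (1 : NNReal)))⁻¹ *
      Real.exp (-(x - 0) ^ 2 / (2 * (1 : NNReal))))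
      ((√(2 * π * (1 : NNReal)))⁻¹ * (Real.exp (-(x - 0) ^ 2 / (2 * (1 : NNReal))) * -x)) x := by
    refine (HasDerivAt.exp ?_).const_mul _
    have h1 : HasDerivAt (fun x : ℝ => -(x - 0) ^ 2 / (2 * (1 : NNReal)))
        (-(2 * (x - 0) ^ (2 - 1) * 1) / (2 * (1 : NNReal))) x := by
      simpa using ((((hasDerivAt_id x).sub_const 0).pow 2).neg).div_const (2 * ((1 : NNReal) : ℝ))
    convert h1 using 1
    simp
    ring
  rw [show gaussianPDFReal 0 1 = fun x : ℝ => (√(2 * π * (1 : NNReal)))⁻¹ *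
      Real.exp (-(x - 0) ^ 2 / (2 * (1 : NNReal))) from rfl]
  convert h using 1
  ring

/-- Gaussian integration by parts. -/
theorem integral_X_mul_gaussian (P : ℝ[X]) :
    ∫ x, x * P.eval x ∂(gaussianReal 0 1) = ∫ x, (derivative P).eval x ∂(gaussianReal 0 1) := by
  have hd : ∀ x, HasDerivAt (fun x => P.eval x * gaussianPDFReal 0 1 x)
      ((derivative P - X * P).eval x * gaussianPDFReal 0 1 x) x := by
    intro x
    refine ((P.hasDerivAt x).mul (hasDerivAt_gaussianPDFReal x)).congr_deriv ?_
    rw [eval_sub, eval_mul, eval_X]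
    ring
  have h0 := integral_eq_zero_of_hasDerivAt_of_integrable hd
    (integrable_eval_mul_gaussianPDFReal _) (integrable_eval_mul_gaussianPDFReal P)
  have h1 : ∫ x, (derivative P - X * P).eval x ∂(gaussianReal 0 1) = 0 := by
    rw [integral_gaussianReal_eq_integral_smul one_ne_zero]
    refine Eq.trans ?_ h0
    refine integral_congr_ae (Filter.Eventually.of_forall fun x => ?_)
    simp only [smul_eq_mul]
    ring
  have h2 := integrable_eval_gaussian (X * P)
  simp only [eval_sub, eval_mul, eval_X] at h1 h2
  rw [integral_sub (integrable_eval_gaussian _) h2] at h1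
  linarith

/-- In the Gaussian inner product, `X - d/dx` is the adjoint of `d/dx`. Together with
`derivative_hermiteR_succ`, this lowers both indices at once and gives orthogonality. -/
theorem integral_hermiteR_succ_mul (n : ℕ) (P : ℝ[X]) :
    ∫ x, (hermiteR (n + 1)).eval x * P.eval x ∂(gaussianReal 0 1)
      = ∫ x, (hermiteR n).eval x * (derivative P).eval x ∂(gaussianReal 0 1) := by
  have h := integral_X_mul_gaussian (hermiteR n * P)
  have i1 := integrable_eval_gaussian (X * (hermiteR n * P))
  have i2 := integrable_eval_gaussian (derivative (hermiteR n) * P)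
  have i3 := integrable_eval_gaussian (hermiteR n * derivative P)
  simp only [derivative_mul, eval_add, eval_mul, eval_X] at h i1 i2 i3
  rw [integral_add i2 i3] at h
  simp only [hermiteR_succ, eval_sub, eval_mul, eval_X, sub_mul, mul_assoc]
  rw [integral_sub i1 i2]
  linarith

theorem integral_hermiteR_mul_hermiteR (n m : ℕ) :
    ∫ x, (hermiteR n).eval x * (hermiteR m).eval x ∂(gaussianReal 0 1)
      = if n = m then (n.factorial : ℝ) else 0 := by
  induction n generalizing m with
  | zero =>
    cases m with
    | zero => simp [hermiteR_zero]
    | succ m =>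
      have := integral_hermiteR_succ_mul m 1
      simpa [hermiteR_zero] using this
  | succ n ih =>
    rw [integral_hermiteR_succ_mul]
    cases m with
    | zero => simp [hermiteR_zero]
    | succ m =>
      rw [derivative_hermiteR_succ]
      have h := ih m
      have : ∀ x, eval x (hermiteR n) * eval x (((m : ℝ[X]) + 1) * hermiteR m)
          = ((m : ℝ) + 1) * (eval x (hermiteR n) * eval x (hermiteR m)) := by
        intro x; simp; ring
      simp_rw [this]
      rw [integral_const_mul, h]
      by_cases hnm : n = m
      · subst hnm; simp [Nat.factorial_succ]
      · simp [hnm]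

/-- The Mehler identity for Hermite polynomials. -/
theorem integral_hermiteR_comp {a b : ℝ} (hab : a ^ 2 + b ^ 2 = 1) (x : ℝ) (n : ℕ) :
    ∫ w, (hermiteR n).eval (x * a + w * b) ∂(gaussianReal 0 1) = a ^ n * (hermiteR n).eval x := by
  have hint : ∀ P : ℝ[X], Integrable (fun w => P.eval (x * a + w * b)) (gaussianReal 0 1) := by
    intro P
    have h := integrable_eval_gaussian (P.comp (C (x * a) + X * C b))
    simpa only [eval_comp, eval_add, eval_mul, eval_C, eval_X] using h
  have hint' : ∀ P : ℝ[X], Integrable (fun w => w * P.eval (x * a + w * b)) (gaussianReal 0 1) := by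
    intro P
    have h := integrable_eval_gaussian (X * P.comp (C (x * a) + X * C b))
    simpa only [eval_comp, eval_add, eval_mul, eval_C, eval_X] using h
  have hibp : ∀ P : ℝ[X], ∫ w, w * P.eval (x * a + w * b) ∂(gaussianReal 0 1)
      = b * ∫ w, (derivative P).eval (x * a + w * b) ∂(gaussianReal 0 1) := by
    intro P
    have h := integral_X_mul_gaussian (P.comp (C (x * a) + X * C b))
    have e : ∀ w, (derivative (P.comp (C (x * a) + X * C b))).eval w
        = b * (derivative P).eval (x * a + w * b) := by
      intro w
      simp only [derivative_comp, derivative_add, derivative_C, derivative_mul, derivative_X,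
        eval_mul, eval_comp, eval_add, eval_C, eval_X]
      simp
    simp only [e, integral_const_mul, eval_comp, eval_add, eval_mul, eval_C, eval_X] at h
    exact h
  -- Apply `H_{n+1}(y) = y H_n(y) - H_n'(y)` at `y = xa + wb`. Integration by parts turns the factor
  -- `wb` into `b² d/dy`, and `b² - 1 = -a²`.
  have hstep : ∀ n, ∫ w, (hermiteR (n + 1)).eval (x * a + w * b) ∂(gaussianReal 0 1)
      = x * a * ∫ w, (hermiteR n).eval (x * a + w * b) ∂(gaussianReal 0 1)
        - a ^ 2 * ∫ w, (derivative (hermiteR n)).eval (x * a + w * b) ∂(gaussianReal 0 1) := by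
    intro n
    have e : ∀ w, (hermiteR (n + 1)).eval (x * a + w * b)
        = x * a * (hermiteR n).eval (x * a + w * b) + b * (w * (hermiteR n).eval (x * a + w * b))
          - (derivative (hermiteR n)).eval (x * a + w * b) := by
      intro w; simp [hermiteR_succ]; ring
    simp_rw [e]
    have i1 : Integrable (fun w => x * a * (hermiteR n).eval (x * a + w * b)
        + b * (w * (hermiteR n).eval (x * a + w * b))) (gaussianReal 0 1) :=
      ((hint _).const_mul _).add ((hint' _).const_mul _)
    rw [integral_sub i1 (hint _),
      integral_add ((hint _).const_mul _) ((hint' _).const_mul _), integral_const_mul,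
      integral_const_mul, hibp]
    linear_combination
      (∫ w, (derivative (hermiteR n)).eval (x * a + w * b) ∂(gaussianReal 0 1)) * hab
  -- Two steps are needed because `H_{n+1}'` is a multiple of `H_n`.
  induction n using Nat.twoStepInduction with
  | zero => simp [hermiteR_zero]
  | one => rw [hstep]; simp [hermiteR_zero, hermiteR_one]; ring
  | more n ih1 ih2 =>
    rw [hstep, ih2, hermiteR_succ (n + 1), derivative_hermiteR_succ]
    simp only [eval_mul, eval_add, eval_natCast, eval_one, eval_sub, eval_X, integral_const_mul,
      ih1]
    ring

end HermitePolynomials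

/-! ### Hermite functions at inverse temperature `β` and their products -/

/-- The Hermite functions adapted to the Maxwellian at inverse temperature `β`. -/
def hermiteFun (β : ℝ) (n : ℕ) (x : ℝ) : ℝ := (hermiteR n).eval (√β * x)

theorem continuous_hermiteFun (β : ℝ) (n : ℕ) : Continuous (hermiteFun β n) := by
  unfold hermiteFun; fun_prop

theorem measurePreserving_sqrt_mul {β : ℝ} (hβ : 0 < β) :
    MeasurePreserving (fun x => √β * x) (oneMeasure β) (gaussianReal 0 1) := by
  refine ⟨by fun_prop, ?_⟩
  rw [oneMeasure, gaussianReal_map_const_mul]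
  congr 1
  · simp
  · ext
    simp only [NNReal.coe_mul, NNReal.coe_mk, Real.coe_toNNReal _ (inv_pos.2 hβ).le,
      Real.sq_sqrt hβ.le, NNReal.coe_one]
    field_simp

theorem integrable_hermiteFun_mul {β : ℝ} (hβ : 0 < β) (n m : ℕ) :
    Integrable (fun x => hermiteFun β n x * hermiteFun β m x) (oneMeasure β) := by
  have h := (measurePreserving_sqrt_mul hβ).integrable_comp_of_integrable
    (integrable_eval_gaussian (hermiteR n * hermiteR m))
  simpa [Function.comp_def, hermiteFun] using h

theorem integral_hermiteFun_mul {β : ℝ} (hβ : 0 < β) (n m : ℕ) :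
    ∫ x, hermiteFun β n x * hermiteFun β m x ∂(oneMeasure β)
      = if n = m then (n.factorial : ℝ) else 0 := by
  rw [← integral_hermiteR_mul_hermiteR n m, ← integral_comp_measurePreserving
    (measurePreserving_sqrt_mul hβ) (f := fun x => (hermiteR n).eval x * (hermiteR m).eval x)]
  · rfl
  · exact (by fun_prop : Continuous _).aestronglyMeasurable

theorem integral_hermiteFun_collision {β : ℝ} (hβ : 0 < β) (n : ℕ) (θ x : ℝ) :
    ∫ w, hermiteFun β n (x * cos θ + w * sin θ) ∂(oneMeasure β)
      = cos θ ^ n * hermiteFun β n x := by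
  have h := integral_hermiteR_comp (cos_sq_add_sin_sq θ) (√β * x) n
  rw [← integral_comp_measurePreserving (measurePreserving_sqrt_mul hβ)] at h
  · rw [hermiteFun, ← h]
    refine integral_congr_ae (Filter.Eventually.of_forall fun w => ?_)
    simp only [hermiteFun]
    ring_nf
  · exact (by fun_prop : Continuous _).aestronglyMeasurable

/-- The three-term recurrence. At `n = 0` the truncated index `n - 1` is harmless, since its
coefficient vanishes. -/
theorem mul_hermiteFun {β : ℝ} (hβ : 0 < β) (n : ℕ) (x : ℝ) :
    x * hermiteFun β n x
      = (√β)⁻¹ * hermiteFun β (n + 1) x + ((√β)⁻¹ * n) * hermiteFun β (n - 1) x := by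
  have h : √β ≠ 0 := (Real.sqrt_pos.2 hβ).ne'
  cases n with
  | zero =>
    simp only [hermiteFun, hermiteR_zero, hermiteR_one, Polynomial.eval_one, Polynomial.eval_X,
      zero_add]
    field_simp
    simp
  | succ n =>
    simp only [hermiteFun, hermiteR_succ (n + 1), derivative_hermiteR_succ, Polynomial.eval_sub,
      Polynomial.eval_mul, Polynomial.eval_X, Polynomial.eval_add, Polynomial.eval_natCast,
      Polynomial.eval_one, Nat.add_sub_cancel]
    push_cast
    field_simp
    ring

/-- Products of Hermite functions. -/
def hermiteProd (β : ℝ) (α : Fin N → ℕ) (v : Fin N → ℝ) : ℝ := ∏ k, hermiteFun β (α k) (v k)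

theorem continuous_hermiteProd (β : ℝ) (α : Fin N → ℕ) : Continuous (hermiteProd β α) :=
  continuous_finsetProd _ fun k _ => (continuous_hermiteFun β (α k)).comp (continuous_apply k)

theorem memLp_hermiteProd {β : ℝ} (hβ : 0 < β) (α : Fin N → ℕ) :
    MemLp (hermiteProd β α) 2 (Measure.pi fun _ => oneMeasure β) := by
  rw [memLp_two_iff_integrable_sq (continuous_hermiteProd β α).aestronglyMeasurable]
  have h := Integrable.fintype_prod (ι := Fin N) (μ := fun _ => oneMeasure β)
    fun k => integrable_hermiteFun_mul hβ (α k) (α k)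
  simpa only [hermiteProd, ← Finset.prod_mul_distrib, pow_two] using h

theorem integral_hermiteProd_mul {β : ℝ} (hβ : 0 < β) (α α' : Fin N → ℕ) :
    ∫ v, hermiteProd β α v * hermiteProd β α' v ∂(Measure.pi fun _ : Fin N => oneMeasure β)
      = if α = α' then ∏ k, ((α k).factorial : ℝ) else 0 := by
  simp only [hermiteProd, ← Finset.prod_mul_distrib]
  rw [integral_fintype_prod_eq_prod
    (f := fun k x => hermiteFun β (α k) x * hermiteFun β (α' k) x)]
  simp only [integral_hermiteFun_mul hβ]
  by_cases h : α = α'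
  · subst h; simp
  · rw [if_neg h]
    obtain ⟨k, hk⟩ := Function.ne_iff.1 h
    exact Finset.prod_eq_zero (Finset.mem_univ k) (if_neg hk)

/-- Updating degree and velocity together serves two purposes: bath collisions, where `α` is kept,
and multiplication by a coordinate, where `v` is kept. -/
theorem hermiteProd_update (β : ℝ) (α : Fin N → ℕ) (j : Fin N) (n : ℕ) (x : ℝ)
    (v : Fin N → ℝ) :
    hermiteProd β (Function.update α j n) (Function.update v j x)
      = hermiteFun β n x * ∏ k ∈ Finset.univ.erase j, hermiteFun β (α k) (v k) := by
  rw [hermiteProd, ← Finset.mul_prod_erase _ _ (Finset.mem_univ j)]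
  simp only [Function.update_self]
  congr 1
  refine Finset.prod_congr rfl fun k hk => ?_
  rw [Function.update_of_ne (Finset.ne_of_mem_erase hk),
    Function.update_of_ne (Finset.ne_of_mem_erase hk)]

theorem hermiteProd_eq_mul_erase (β : ℝ) (α : Fin N → ℕ) (j : Fin N) (v : Fin N → ℝ) :
    hermiteProd β α v
      = hermiteFun β (α j) (v j) * ∏ k ∈ Finset.univ.erase j, hermiteFun β (α k) (v k) := by
  rw [hermiteProd, Finset.mul_prod_erase _ (fun k => hermiteFun β (α k) (v k))
    (Finset.mem_univ j)]

theorem integral_hermiteProd_bathCollision {β : ℝ} (hβ : 0 < β) (α : Fin N → ℕ) (j : Fin N)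
    (θ : ℝ) (v : Fin N → ℝ) :
    ∫ w, hermiteProd β α (bathCollision j θ w v) ∂(oneMeasure β)
      = cos θ ^ α j * hermiteProd β α v := by
  have h : ∀ w, hermiteProd β α (bathCollision j θ w v)
      = hermiteFun β (α j) (v j * cos θ + w * sin θ)
        * ∏ k ∈ Finset.univ.erase j, hermiteFun β (α k) (v k) := by
    intro w
    have := hermiteProd_update β α j (α j) (v j * cos θ + w * sin θ) v
    rwa [Function.update_eq_self] at this
  simp_rw [h]
  rw [integral_mul_const, integral_hermiteFun_collision hβ, hermiteProd_eq_mul_erase β α j]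
  ring

theorem coord_mul_hermiteProd {β : ℝ} (hβ : 0 < β) (α : Fin N → ℕ) (j : Fin N)
    (v : Fin N → ℝ) :
    v j * hermiteProd β α v
      = (√β)⁻¹ * hermiteProd β (Function.update α j (α j + 1)) v
        + ((√β)⁻¹ * α j) * hermiteProd β (Function.update α j (α j - 1)) v := by
  have h := fun n => hermiteProd_update β α j n (v j) v
  simp only [Function.update_eq_self] at h
  rw [h, h, hermiteProd_eq_mul_erase β α j, ← mul_assoc, mul_hermiteFun hβ]
  ring

theorem hermiteProd_zero (β : ℝ) (v : Fin N → ℝ) : hermiteProd β 0 v = 1 := by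
  simp [hermiteProd, hermiteFun, hermiteR_zero]

theorem hermiteProd_single_two {β : ℝ} (hβ : 0 < β) (j : Fin N) (v : Fin N → ℝ) :
    hermiteProd β (Pi.single j 2) v = β * (v j ^ 2 - 1 / β) := by
  have h : hermiteProd β (Pi.single j 2) v = (hermiteR 2).eval (√β * v j) := by
    rw [hermiteProd_eq_mul_erase β _ j, Finset.prod_eq_one, Pi.single_eq_same, mul_one, hermiteFun]
    intro k hk
    rw [Pi.single_eq_of_ne (Finset.ne_of_mem_erase hk)]
    simp [hermiteFun, hermiteR_zero]
  rw [h, hermiteR_succ, hermiteR_one]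
  simp only [Polynomial.derivative_X, Polynomial.eval_sub, Polynomial.eval_mul, Polynomial.eval_X,
    Polynomial.eval_one]
  have := Real.mul_self_sqrt hβ.le
  field_simp
  linear_combination v j ^ 2 * this

theorem hermiteProd_mem_span (β : ℝ) (α : Fin N → ℕ) :
    hermiteProd β α ∈ Submodule.span ℝ (Set.range (hermiteProd (N := N) β)) :=
  Submodule.subset_span ⟨α, rfl⟩

theorem coord_mul_mem_span {β : ℝ} (hβ : 0 < β) (j : Fin N) {q : (Fin N → ℝ) → ℝ}
    (hq : q ∈ Submodule.span ℝ (Set.range (hermiteProd (N := N) β))) :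
    (fun v => v j * q v) ∈ Submodule.span ℝ (Set.range (hermiteProd (N := N) β)) := by
  induction hq using Submodule.span_induction with
  | mem q hq =>
    obtain ⟨α, rfl⟩ := hq
    simp only [coord_mul_hermiteProd hβ]
    exact Submodule.add_mem _
      (Submodule.smul_mem _ (√β)⁻¹ (hermiteProd_mem_span β (Function.update α j (α j + 1))))
      (Submodule.smul_mem _ ((√β)⁻¹ * α j)
        (hermiteProd_mem_span β (Function.update α j (α j - 1))))
  | zero =>
    simp only [Pi.zero_apply, mul_zero]
    exact Submodule.zero_mem (Submodule.span ℝ (Set.range (hermiteProd (N := N) β)))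
  | add p q _ _ hp hq =>
    simp only [Pi.add_apply, mul_add]
    exact Submodule.add_mem _ hp hq
  | smul c q _ hq =>
    simp only [Pi.smul_apply, mul_smul_comm]
    exact Submodule.smul_mem _ c hq

/-- Powers of linear forms are the only polynomials that completeness requires: they are the Taylor
terms of the characters. -/
theorem linear_pow_mem_span {β : ℝ} (hβ : 0 < β) (t : Fin N → ℝ) (n : ℕ) :
    (fun v : Fin N → ℝ => (∑ k, t k * v k) ^ n)
      ∈ Submodule.span ℝ (Set.range (hermiteProd (N := N) β)) := by
  induction n with
  | zero =>
    have h := hermiteProd_mem_span (N := N) β 0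
    rwa [show hermiteProd β (0 : Fin N → ℕ) = fun v => (∑ k, t k * v k) ^ 0 by
      funext v; simp [hermiteProd_zero]] at h
  | succ n ih =>
    have h : (fun v : Fin N → ℝ => (∑ k, t k * v k) ^ (n + 1))
        = ∑ k, t k • fun v : Fin N → ℝ => v k * (∑ k, t k * v k) ^ n := by
      funext v
      simp only [Finset.sum_apply, Pi.smul_apply, smul_eq_mul, pow_succ', Finset.sum_mul, mul_assoc]
    rw [h]
    exact Submodule.sum_mem _ fun k _ => Submodule.smul_mem _ _ (coord_mul_mem_span hβ k ih)

theorem memLp_of_mem_span {β : ℝ} (hβ : 0 < β) {q : (Fin N → ℝ) → ℝ}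
    (hq : q ∈ Submodule.span ℝ (Set.range (hermiteProd (N := N) β))) :
    MemLp q 2 (Measure.pi fun _ => oneMeasure β) := by
  induction hq using Submodule.span_induction with
  | mem q hq => obtain ⟨α, rfl⟩ := hq; exact memLp_hermiteProd hβ α
  | zero => exact MemLp.zero
  | add p q _ _ hp hq => exact hp.add hq
  | smul c q _ hq => exact hq.const_smul c

theorem integral_mul_eq_zero_of_mem_span {β : ℝ} (hβ : 0 < β) {f q : (Fin N → ℝ) → ℝ}
    (hf : MemLp f 2 (Measure.pi fun _ => oneMeasure β))
    (h0 : ∀ α, ∫ v, hermiteProd β α v * f v ∂(Measure.pi fun _ => oneMeasure β) = 0)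
    (hq : q ∈ Submodule.span ℝ (Set.range (hermiteProd (N := N) β))) :
    ∫ v, q v * f v ∂(Measure.pi fun _ => oneMeasure β) = 0 := by
  induction hq using Submodule.span_induction with
  | mem q hq => obtain ⟨α, rfl⟩ := hq; exact h0 α
  | zero => simp
  | add p q hp' hq' hp hq =>
    simp only [Pi.add_apply, add_mul]
    rw [integral_add (f := fun v => p v * f v) (g := fun v => q v * f v)
      ((memLp_of_mem_span hβ hp').integrable_mul hf)
      ((memLp_of_mem_span hβ hq').integrable_mul hf), hp, hq, add_zero]
  | smul c q _ hq =>
    simp only [Pi.smul_apply, smul_eq_mul, mul_assoc]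
    rw [integral_const_mul, hq, mul_zero]

/-! ### Completeness of the Hermite products -/

theorem integrable_exp_linear (β : ℝ) (t : Fin N → ℝ) :
    Integrable (fun v : Fin N → ℝ => exp (∑ k, t k * v k)) (Measure.pi fun _ => oneMeasure β) := by
  simp only [Real.exp_sum]
  exact Integrable.fintype_prod (f := fun k x => exp (t k * x))
    fun k => integrable_exp_mul_gaussianReal (t k)

/-- From `exp (2|x|) ≤ exp (2x) + exp (-2x)`. It provides the dominating function for the expansion
of the characters. -/
theorem memLp_exp_abs_linear (β : ℝ) (t : Fin N → ℝ) :
    MemLp (fun v : Fin N → ℝ => exp |∑ k, t k * v k|) 2 (Measure.pi fun _ => oneMeasure β) := by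
  have hc : Continuous (fun v : Fin N → ℝ => exp |∑ k, t k * v k|) := by fun_prop
  rw [memLp_two_iff_integrable_sq hc.aestronglyMeasurable]
  refine Integrable.mono' ((integrable_exp_linear β fun k => 2 * t k).add
    (integrable_exp_linear β fun k => -(2 * t k))) (hc.pow 2).aestronglyMeasurable
    (Filter.Eventually.of_forall fun v => ?_)
  have e1 : ∑ k, 2 * t k * v k = 2 * ∑ k, t k * v k := by
    rw [Finset.mul_sum]; simp only [mul_assoc]
  have e2 : ∑ k, -(2 * t k) * v k = -(2 * ∑ k, t k * v k) := by
    rw [← e1, ← Finset.sum_neg_distrib]; simp only [neg_mul]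
  rw [Pi.add_apply, e1, e2, Real.norm_eq_abs, abs_of_nonneg (sq_nonneg _), ← Real.exp_nat_mul]
  rcases abs_cases (∑ k, t k * v k) with ⟨h, _⟩ | ⟨h, _⟩ <;> rw [h] <;> push_cast
  · exact le_add_of_nonneg_right (exp_pos _).le
  · rw [mul_neg]; exact le_add_of_nonneg_left (exp_pos _).le

/-- A square integrable function orthogonal to all polynomials has vanishing Fourier transform. -/
theorem integral_cexp_mul_eq_zero {β : ℝ} (hβ : 0 < β) {f : (Fin N → ℝ) → ℝ}
    (hf : MemLp f 2 (Measure.pi fun _ => oneMeasure β))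
    (h0 : ∀ α, ∫ v, hermiteProd β α v * f v ∂(Measure.pi fun _ => oneMeasure β) = 0)
    (t : Fin N → ℝ) :
    ∫ v : Fin N → ℝ, Complex.exp (((∑ k, t k * v k : ℝ) : ℂ) * Complex.I) * (f v : ℂ)
      ∂(Measure.pi fun _ => oneMeasure β) = 0 := by
  set ℓ : (Fin N → ℝ) → ℝ := fun v => ∑ k, t k * v k with hℓ
  have hℓc : Continuous ℓ := by fun_prop
  -- The exponential series is integrated term by term; the absolute values of its terms sum to `exp
  -- |ℓ| * |f|`, a product of two `L²` functions.
  have hs := hasSum_integral_of_dominated_convergence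
    (μ := Measure.pi fun _ : Fin N => oneMeasure β)
    (F := fun (n : ℕ) v => ((ℓ v : ℂ) * Complex.I) ^ n / (n.factorial : ℂ) * (f v : ℂ))
    (f := fun v => Complex.exp ((ℓ v : ℂ) * Complex.I) * (f v : ℂ))
    (fun (n : ℕ) v => |ℓ v| ^ n / n.factorial * |f v|)
    (fun n => ((by fun_prop : Continuous fun v : Fin N → ℝ =>
      ((ℓ v : ℂ) * Complex.I) ^ n / (n.factorial : ℂ)).aestronglyMeasurable).mul
        (Complex.continuous_ofReal.comp_aestronglyMeasurable hf.1))
    (fun n => Filter.Eventually.of_forall fun v => by simp)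
    (Filter.Eventually.of_forall fun v => (Real.summable_pow_div_factorial _).mul_right _)
    (by
      have h := (memLp_exp_abs_linear β t).integrable_mul hf.abs
      refine h.congr (Filter.Eventually.of_forall fun v => ?_)
      simp only [Pi.mul_apply]
      rw [tsum_mul_right, Real.exp_eq_exp_ℝ, NormedSpace.exp_eq_tsum_div]
      rfl)
    (Filter.Eventually.of_forall fun v => by
      refine HasSum.mul_right _ ?_
      rw [Complex.exp_eq_exp_ℂ]
      exact NormedSpace.expSeries_div_hasSum_exp _)
  have hz : ∀ n : ℕ, ∫ v, ((ℓ v : ℂ) * Complex.I) ^ n / (n.factorial : ℂ) * (f v : ℂ)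
      ∂(Measure.pi fun _ : Fin N => oneMeasure β) = 0 := by
    intro n
    have e : ∀ v, ((ℓ v : ℂ) * Complex.I) ^ n / (n.factorial : ℂ) * (f v : ℂ)
        = (Complex.I ^ n / (n.factorial : ℂ)) * ((ℓ v ^ n * f v : ℝ) : ℂ) := by
      intro v; push_cast; ring
    simp_rw [e]
    rw [integral_const_mul, integral_complex_ofReal,
      integral_mul_eq_zero_of_mem_span hβ hf h0 (linear_pow_mem_span hβ t n)]
    simp
  simp only [hz] at hs
  exact (hs.unique hasSum_zero)

/-- `ENNReal.ofReal` truncates at zero, so `f` and `-f` give the positive and negative parts of `f`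
as densities. These two finite measures have equal characteristic functions, hence the parts agree
almost everywhere; as one of them is always zero, both are. -/
theorem ae_eq_zero_of_charFunDual {E : Type*} [NormedAddCommGroup E] [NormedSpace ℝ E]
    [CompleteSpace E] [SecondCountableTopology E] [MeasurableSpace E] [BorelSpace E]
    {γ : Measure E} [IsFiniteMeasure γ] {f : E → ℝ} (hf : Integrable f γ)
    (h0 : ∀ L : StrongDual ℝ E, ∫ v, Complex.exp ((L v : ℂ) * Complex.I) * (f v : ℂ) ∂γ = 0) :
    f =ᵐ[γ] 0 := by
  have hfm := hf.1.aemeasurable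
  have hfin : IsFiniteMeasure (γ.withDensity fun v => ENNReal.ofReal (f v)) :=
    isFiniteMeasure_withDensity_ofReal hf.2
  have hfin' : IsFiniteMeasure (γ.withDensity fun v => ENNReal.ofReal (-f v)) :=
    isFiniteMeasure_withDensity_ofReal hf.neg.2
  have key : ∀ g : E → ℝ, Integrable g γ → ∀ L : StrongDual ℝ E,
      charFunDual (γ.withDensity fun v => ENNReal.ofReal (g v)) L
        = ∫ v, Complex.exp ((L v : ℂ) * Complex.I) * ((max (g v) 0 : ℝ) : ℂ) ∂γ := by
    intro g hg L
    rw [charFunDual_apply, integral_withDensity_eq_integral_toReal_smul₀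
      hg.1.aemeasurable.ennreal_ofReal (Filter.Eventually.of_forall fun _ => ENNReal.ofReal_lt_top)]
    refine integral_congr_ae (Filter.Eventually.of_forall fun v => ?_)
    simp only [ENNReal.toReal_ofReal', Complex.real_smul]
    ring
  have hint : ∀ g : E → ℝ, Integrable g γ → ∀ L : StrongDual ℝ E,
      Integrable (fun v => Complex.exp ((L v : ℂ) * Complex.I) * ((max (g v) 0 : ℝ) : ℂ)) γ := by
    intro g hg L
    refine hg.pos_part.ofReal.bdd_mul (c := 1)
      (by fun_prop : Continuous fun v => Complex.exp ((L v : ℂ) * Complex.I)).aestronglyMeasurable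
      (Filter.Eventually.of_forall fun v => ?_)
    rw [Complex.norm_exp_ofReal_mul_I]
  have heq : (γ.withDensity fun v => ENNReal.ofReal (f v))
      = γ.withDensity fun v => ENNReal.ofReal (-f v) := by
    refine Measure.ext_of_charFunDual (funext fun L => ?_)
    rw [key f hf, key (fun v => -f v) hf.neg, ← sub_eq_zero,
      ← integral_sub (hint f hf L) (hint (fun v => -f v) hf.neg L), ← h0 L]
    refine integral_congr_ae (Filter.Eventually.of_forall fun v => ?_)
    simp only [← mul_sub, ← Complex.ofReal_sub]
    congr 2
    rcases le_total 0 (f v) with h | h <;> simp [h]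
  have hae := (withDensity_eq_iff hfm.ennreal_ofReal hfm.neg.ennreal_ofReal
    (by simpa using hfin.measure_univ_lt_top.ne)).1 heq
  filter_upwards [hae] with v hv
  simp only [Pi.zero_apply]
  rcases lt_trichotomy (f v) 0 with h | h | h
  · rw [ENNReal.ofReal_of_nonpos h.le] at hv
    exact absurd hv.symm (by simpa using h)
  · exact h
  · rw [Pi.neg_apply, ENNReal.ofReal_of_nonpos (p := -f v) (by linarith)] at hv
    exact absurd hv (by simpa using h)

/-- Completeness of the Hermite functions. -/
theorem ae_eq_zero_of_integral_hermiteProd {β : ℝ} (hβ : 0 < β) {f : (Fin N → ℝ) → ℝ}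
    (hf : MemLp f 2 (Measure.pi fun _ => oneMeasure β))
    (h0 : ∀ α, ∫ v, hermiteProd β α v * f v ∂(Measure.pi fun _ => oneMeasure β) = 0) :
    f =ᵐ[Measure.pi fun _ => oneMeasure β] 0 := by
  refine ae_eq_zero_of_charFunDual (hf.integrable one_le_two) fun L => ?_
  have h := integral_cexp_mul_eq_zero hβ hf h0 fun k => L (Pi.single k 1)
  rw [← h]
  refine integral_congr_ae (Filter.Eventually.of_forall fun v => ?_)
  have e : L v = ∑ k, L (Pi.single k 1) * v k := by
    conv_lhs => rw [pi_eq_sum_univ' v, map_sum]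
    refine Finset.sum_congr rfl fun k _ => ?_
    rw [map_smul, smul_eq_mul, mul_comm]
  simp only [e]

/-! ### The operators `Q`, `T_j` and the generator on `L²` -/

/-- The average over the angle of the collisions of the particles `i` and `j`. -/
def pairAverage (i j : Fin N) (h : (Fin N → ℝ) → ℝ) (v : Fin N → ℝ) : ℝ :=
  ∫ θ, h (pairCollision i j θ v) ∂angleMeasure

theorem kacQ_eq (h : (Fin N → ℝ) → ℝ) (v : Fin N → ℝ) :
    kacQ h v = (1 / (N.choose 2 : ℝ)) *
      ∑ i : Fin N, ∑ j ∈ Finset.Ioi i, pairAverage i j h v := rfl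

theorem measurePreserving_pairCollision_prod (β : ℝ) {i j : Fin N} (hij : i ≠ j) :
    MeasurePreserving (fun p : (Fin N → ℝ) × ℝ => pairCollision i j p.2 p.1)
      ((Measure.pi fun _ => oneMeasure β).prod angleMeasure) (Measure.pi fun _ => oneMeasure β) :=
  measurePreserving_uncurry (measurable_pairCollision i j)
    fun θ => measurePreserving_pairCollision hij θ

/-- The average over bath velocity and angle, as an integral over the product. -/
def bathAverage (β : ℝ) (j : Fin N) (h : (Fin N → ℝ) → ℝ) (v : Fin N → ℝ) : ℝ :=
  ∫ q : ℝ × ℝ, h (bathCollision j q.2 q.1 v) ∂((oneMeasure β).prod angleMeasure)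

theorem measurePreserving_bathCollision_prod_right (β : ℝ) (j : Fin N) :
    MeasurePreserving (fun p : ((Fin N → ℝ) × ℝ) × ℝ => bathCollision j p.2 p.1.2 p.1.1)
      (((Measure.pi fun _ => oneMeasure β).prod (oneMeasure β)).prod angleMeasure)
      (Measure.pi fun _ => oneMeasure β) :=
  measurePreserving_uncurry (F := fun θ (p : (Fin N → ℝ) × ℝ) => bathCollision j θ p.2 p.1)
    (measurable_bathCollision j) fun θ => measurePreserving_bathCollision β j θ

theorem measurePreserving_bathCollision_prod (β : ℝ) (j : Fin N) :
    MeasurePreserving (fun p : (Fin N → ℝ) × (ℝ × ℝ) => bathCollision j p.2.2 p.2.1 p.1)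
      ((Measure.pi fun _ => oneMeasure β).prod ((oneMeasure β).prod angleMeasure))
      (Measure.pi fun _ => oneMeasure β) := by
  have h := (measurePreserving_prodAssoc (Measure.pi fun _ : Fin N => oneMeasure β)
    (oneMeasure β) angleMeasure).symm
  exact (measurePreserving_bathCollision_prod_right β j).comp h

/-- Fubini identifies the iterated integral with the product integral only where the slice is
integrable, hence only for almost every `v`. -/
theorem bathT_ae_eq_bathAverage {β : ℝ} (hβ : 0 < β) (j : Fin N) {h : (Fin N → ℝ) → ℝ}
    (hh : MemLp h 2 (Measure.pi fun _ => oneMeasure β)) :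
    bathT β j h =ᵐ[Measure.pi fun _ => oneMeasure β] bathAverage β j h := by
  have hi := (measurePreserving_bathCollision_prod β j).integrable_comp_of_integrable
    (hh.integrable one_le_two)
  filter_upwards [hi.prod_right_ae] with v hv
  rw [bathT, integral_maxwellian_mul hβ, bathAverage]
  simp only [interval_average_eq_angleMeasure]
  exact (integral_prod _ hv).symm

theorem bathT_congr_ae {β : ℝ} (hβ : 0 < β) (j : Fin N) {h k : (Fin N → ℝ) → ℝ}
    (hh : MemLp h 2 (Measure.pi fun _ => oneMeasure β))
    (hk : h =ᵐ[Measure.pi fun _ => oneMeasure β] k) :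
    bathT β j h =ᵐ[Measure.pi fun _ => oneMeasure β] bathT β j k :=
  (bathT_ae_eq_bathAverage hβ j hh).trans
    ((average_congr_ae (measurePreserving_bathCollision_prod β j) hk).trans
      (bathT_ae_eq_bathAverage hβ j (hh.ae_eq hk)).symm)

theorem memLp_bathT {β : ℝ} (hβ : 0 < β) (j : Fin N) {h : (Fin N → ℝ) → ℝ}
    (hh : MemLp h 2 (Measure.pi fun _ => oneMeasure β)) :
    MemLp (bathT β j h) 2 (Measure.pi fun _ => oneMeasure β) :=
  (memLp_average (measurePreserving_bathCollision_prod β j) hh).ae_eq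
    (bathT_ae_eq_bathAverage hβ j hh).symm

theorem memLp_pairAverage {β : ℝ} {i j : Fin N} (hij : i ≠ j) {h : (Fin N → ℝ) → ℝ}
    (hh : MemLp h 2 (Measure.pi fun _ => oneMeasure β)) :
    MemLp (pairAverage i j h) 2 (Measure.pi fun _ => oneMeasure β) :=
  memLp_average (measurePreserving_pairCollision_prod β hij) hh

theorem memLp_kacQ {β : ℝ} {h : (Fin N → ℝ) → ℝ}
    (hh : MemLp h 2 (Measure.pi fun _ => oneMeasure β)) :
    MemLp (kacQ h) 2 (Measure.pi fun _ => oneMeasure β) := by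
  refine MemLp.const_mul (f := fun v => ∑ i : Fin N, ∑ j ∈ Finset.Ioi i, pairAverage i j h v) ?_ _
  exact memLp_finsetSum _ fun i _ => memLp_finsetSum _ fun j hj =>
    memLp_pairAverage (Finset.mem_Ioi.1 hj).ne hh

theorem kacQ_congr_ae {β : ℝ} {h k : (Fin N → ℝ) → ℝ}
    (hk : h =ᵐ[Measure.pi fun _ => oneMeasure β] k) :
    kacQ h =ᵐ[Measure.pi fun _ => oneMeasure β] kacQ k := by
  have h1 : ∀ᵐ v ∂(Measure.pi fun _ : Fin N => oneMeasure β), ∀ i : Fin N, ∀ j : Fin N,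
      i ≠ j → pairAverage i j h v = pairAverage i j k v := by
    simp only [ae_all_iff]
    exact fun i j hij => average_congr_ae (measurePreserving_pairCollision_prod β hij) hk
  filter_upwards [h1] with v hv
  rw [kacQ_eq, kacQ_eq]
  congr 1
  exact Finset.sum_congr rfl fun i _ => Finset.sum_congr rfl fun j hj =>
    hv i j (Finset.mem_Ioi.1 hj).ne

/-- The bath part `∑ⱼ (I - T_j)` of the generator. -/
def bathGenerator (β : ℝ) (h : (Fin N → ℝ) → ℝ) (v : Fin N → ℝ) : ℝ :=
  ∑ j : Fin N, (h v - bathT β j h v)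

theorem generator_eq (β lam μ : ℝ) (h : (Fin N → ℝ) → ℝ) (v : Fin N → ℝ) :
    generator β lam μ h v = lam * N * (h v - kacQ h v) + μ * bathGenerator β h v := rfl

theorem memLp_bathGenerator {β : ℝ} (hβ : 0 < β) {h : (Fin N → ℝ) → ℝ}
    (hh : MemLp h 2 (Measure.pi fun _ => oneMeasure β)) :
    MemLp (bathGenerator β h) 2 (Measure.pi fun _ => oneMeasure β) :=
  memLp_finsetSum _ fun j _ => hh.sub (memLp_bathT hβ j hh)

theorem memLp_generator {β : ℝ} (hβ : 0 < β) (lam μ : ℝ) {h : (Fin N → ℝ) → ℝ}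
    (hh : MemLp h 2 (Measure.pi fun _ => oneMeasure β)) :
    MemLp (generator β lam μ h) 2 (Measure.pi fun _ => oneMeasure β) :=
  ((hh.sub (memLp_kacQ hh)).const_mul (lam * N)).add ((memLp_bathGenerator hβ hh).const_mul μ)

theorem generator_congr_ae {β : ℝ} (hβ : 0 < β) (lam μ : ℝ) {h k : (Fin N → ℝ) → ℝ}
    (hh : MemLp h 2 (Measure.pi fun _ => oneMeasure β))
    (hk : h =ᵐ[Measure.pi fun _ => oneMeasure β] k) :
    generator β lam μ h =ᵐ[Measure.pi fun _ => oneMeasure β] generator β lam μ k := by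
  have h1 : ∀ᵐ v ∂(Measure.pi fun _ : Fin N => oneMeasure β), ∀ j : Fin N,
      bathT β j h v = bathT β j k v :=
    ae_all_iff.2 fun j => bathT_congr_ae hβ j hh hk
  filter_upwards [h1, hk, kacQ_congr_ae hk] with v h1 h2 h3
  simp only [generator, h1, h2, h3]

theorem integral_mul_generator {β : ℝ} (hβ : 0 < β) (lam μ : ℝ) {h k : (Fin N → ℝ) → ℝ}
    (hh : MemLp h 2 (Measure.pi fun _ => oneMeasure β))
    (hk : MemLp k 2 (Measure.pi fun _ => oneMeasure β)) :
    ∫ v, k v * generator β lam μ h v ∂(Measure.pi fun _ => oneMeasure β)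
      = lam * N * (∫ v, k v * h v ∂(Measure.pi fun _ => oneMeasure β)
          - ∫ v, k v * kacQ h v ∂(Measure.pi fun _ => oneMeasure β))
        + μ * ∫ v, k v * bathGenerator β h v ∂(Measure.pi fun _ => oneMeasure β) := by
  have i1 : Integrable (fun v => k v * h v) (Measure.pi fun _ => oneMeasure β) :=
    hk.integrable_mul hh
  have i2 : Integrable (fun v => k v * kacQ h v) (Measure.pi fun _ => oneMeasure β) :=
    hk.integrable_mul (memLp_kacQ hh)
  have i3 : Integrable (fun v => k v * bathGenerator β h v) (Measure.pi fun _ => oneMeasure β) :=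
    hk.integrable_mul (memLp_bathGenerator hβ hh)
  have e : ∀ v, k v * generator β lam μ h v
      = lam * N * (k v * h v - k v * kacQ h v) + μ * (k v * bathGenerator β h v) := by
    intro v; rw [generator_eq]; ring
  simp_rw [e]
  have i4 : Integrable (fun v => lam * N * (k v * h v - k v * kacQ h v))
      (Measure.pi fun _ => oneMeasure β) := (i1.sub i2).const_mul _
  rw [integral_add i4 (i3.const_mul _), integral_const_mul, integral_const_mul,
    integral_sub i1 i2]

theorem integral_mul_kacQ {β : ℝ} {h k : (Fin N → ℝ) → ℝ}
    (hh : MemLp h 2 (Measure.pi fun _ => oneMeasure β))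
    (hk : MemLp k 2 (Measure.pi fun _ => oneMeasure β)) :
    ∫ v, k v * kacQ h v ∂(Measure.pi fun _ => oneMeasure β)
      = (1 / (N.choose 2 : ℝ)) * ∑ i : Fin N, ∑ j ∈ Finset.Ioi i,
        ∫ v, k v * pairAverage i j h v ∂(Measure.pi fun _ => oneMeasure β) := by
  have hi : ∀ i : Fin N, ∀ j ∈ Finset.Ioi i, Integrable (fun v => k v * pairAverage i j h v)
      (Measure.pi fun _ => oneMeasure β) := fun i j hj =>
    hk.integrable_mul (memLp_pairAverage (Finset.mem_Ioi.1 hj).ne hh)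
  have e : ∀ v, k v * kacQ h v = (1 / (N.choose 2 : ℝ)) *
      ∑ i : Fin N, ∑ j ∈ Finset.Ioi i, k v * pairAverage i j h v := by
    intro v
    rw [kacQ_eq]
    simp only [← Finset.mul_sum]
    ring
  simp_rw [e]
  rw [integral_const_mul, integral_finsetSum _ fun i _ => integrable_finsetSum _ (hi i)]
  congr 1
  exact Finset.sum_congr rfl fun i _ => integral_finsetSum _ (hi i)

/-- Spreading the normalization of `Q` over the pairs allows statements about `Q` to be proved pair
by pair. -/
theorem sum_card_pairs (N : ℕ) (c : ℝ) :
    ∑ i : Fin N, ∑ _j ∈ Finset.Ioi i, c = (N.choose 2 : ℝ) * c := by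
  have h : ∑ i : Fin N, (N - 1 - (i : ℕ)) = N.choose 2 := by
    rw [Fin.sum_univ_eq_sum_range (fun i => N - 1 - i), Finset.sum_range_reflect (fun i => i),
      Finset.sum_range_id, Nat.choose_two_right]
  simp only [Finset.sum_const, Fin.card_Ioi, nsmul_eq_mul]
  rw [← Finset.sum_mul, ← h]
  push_cast
  rfl

theorem choose_two_pos {N : ℕ} (hN : 2 ≤ N) : (0 : ℝ) < N.choose 2 := by
  exact_mod_cast Nat.choose_pos hN

theorem integral_mul_kacQ_self_le {β : ℝ} (hN : 2 ≤ N) {h : (Fin N → ℝ) → ℝ}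
    (hh : MemLp h 2 (Measure.pi fun _ => oneMeasure β)) :
    ∫ v, h v * kacQ h v ∂(Measure.pi fun _ => oneMeasure β)
      ≤ ∫ v, h v * h v ∂(Measure.pi fun _ => oneMeasure β) := by
  have hc := choose_two_pos hN
  rw [integral_mul_kacQ hh hh, one_div, inv_mul_le_iff₀ hc, ← sum_card_pairs]
  exact Finset.sum_le_sum fun i _ => Finset.sum_le_sum fun j hj =>
    integral_mul_average_self_le
      (measurePreserving_pairCollision_prod β (Finset.mem_Ioi.1 hj).ne) hh

theorem integral_kacQ {β : ℝ} (hN : 2 ≤ N) {h : (Fin N → ℝ) → ℝ}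
    (hh : MemLp h 2 (Measure.pi fun _ => oneMeasure β)) :
    ∫ v, kacQ h v ∂(Measure.pi fun _ => oneMeasure β)
      = ∫ v, h v ∂(Measure.pi fun _ => oneMeasure β) := by
  have hc := choose_two_pos hN
  have h1 := integral_mul_kacQ hh (memLp_const (1 : ℝ))
  simp only [one_mul] at h1
  rw [h1, one_div, inv_mul_eq_iff_eq_mul₀ hc.ne', ← sum_card_pairs]
  exact Finset.sum_congr rfl fun i _ => Finset.sum_congr rfl fun j hj =>
    integral_average (measurePreserving_pairCollision_prod β (Finset.mem_Ioi.1 hj).ne) hh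

theorem kacQ_eq_self (hN : 2 ≤ N) {h : (Fin N → ℝ) → ℝ}
    (hinv : ∀ (i j : Fin N) (θ : ℝ) (v : Fin N → ℝ), i ≠ j → h (pairCollision i j θ v) = h v)
    (v : Fin N → ℝ) : kacQ h v = h v := by
  have hc := choose_two_pos hN
  rw [kacQ_eq, one_div, inv_mul_eq_iff_eq_mul₀ hc.ne', ← sum_card_pairs]
  refine Finset.sum_congr rfl fun i _ => Finset.sum_congr rfl fun j hj => ?_
  simp [pairAverage, hinv i j _ v (Finset.mem_Ioi.1 hj).ne]

/-! ### Angular moments and the spectrum of the bath operator -/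

theorem integral_angleMeasure (f : ℝ → ℝ) :
    ∫ θ, f θ ∂angleMeasure = (2 * π)⁻¹ * ∫ θ in (0 : ℝ)..(2 * π), f θ := by
  rw [← interval_average_eq_angleMeasure, interval_average_eq, sub_zero, smul_eq_mul]

/-- The angular averages `(1/2π) ∫ cosⁿ θ dθ`. -/
def cosMoment (n : ℕ) : ℝ := ∫ θ, cos θ ^ n ∂angleMeasure

theorem cosMoment_zero : cosMoment 0 = 1 := by simp [cosMoment]

theorem cosMoment_one : cosMoment 1 = 0 := by simp [cosMoment, integral_angleMeasure]

theorem cosMoment_two : cosMoment 2 = 1 / 2 := by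
  rw [cosMoment, integral_angleMeasure, integral_cos_sq]
  simp
  field_simp

theorem cosMoment_lt {n : ℕ} (hn : 3 ≤ n) : cosMoment n < 1 / 2 := by
  have hpi : (0 : ℝ) < 2 * π := by positivity
  rw [← cosMoment_two, cosMoment, cosMoment, integral_angleMeasure, integral_angleMeasure]
  refine mul_lt_mul_of_pos_left ?_ (inv_pos.2 hpi)
  -- Pointwise `cosⁿ ≤ cos²`, strictly at `π/3`, where the cosine is `1/2`.
  refine intervalIntegral.integral_lt_integral_of_continuousOn_of_le_of_exists_lt hpi
    (by fun_prop) (by fun_prop) (fun x _ => ?_) ⟨π / 3, ⟨by positivity, ?_⟩, ?_⟩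
  · calc cos x ^ n ≤ |cos x ^ n| := le_abs_self _
      _ = |cos x| ^ n := abs_pow _ _
      _ ≤ |cos x| ^ 2 := pow_le_pow_of_le_one (abs_nonneg _) (abs_cos_le_one x) (by omega)
      _ = cos x ^ 2 := sq_abs _
  · linarith [pi_pos]
  · rw [cos_pi_div_three]
    exact pow_lt_pow_right_of_lt_one₀ (by norm_num) (by norm_num) (by omega)

theorem cosMoment_le_half {n : ℕ} (hn : n ≠ 0) : cosMoment n ≤ 1 / 2 := by
  rcases (by omega : n = 1 ∨ n = 2 ∨ 3 ≤ n) with rfl | rfl | h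
  · rw [cosMoment_one]; norm_num
  · rw [cosMoment_two]
  · exact (cosMoment_lt h).le

theorem cosMoment_eq_half {n : ℕ} (h : cosMoment n = 1 / 2) : n = 2 := by
  rcases (by omega : n = 0 ∨ n = 1 ∨ n = 2 ∨ 3 ≤ n) with rfl | rfl | rfl | h3
  · rw [cosMoment_zero] at h; norm_num at h
  · rw [cosMoment_one] at h; norm_num at h
  · rfl
  · exact absurd h (cosMoment_lt h3).ne

theorem cosMoment_le_one (n : ℕ) : cosMoment n ≤ 1 := by
  rcases eq_or_ne n 0 with rfl | h
  · rw [cosMoment_zero]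
  · linarith [cosMoment_le_half h]

/-- The eigenvalue of `∑ⱼ (I - T_j)` at the Hermite function with multi-index `α`. -/
def bathEigenvalue (α : Fin N → ℕ) : ℝ := ∑ j, (1 - cosMoment (α j))

/-- All summands are nonnegative, and a nonzero entry of `α` alone contributes at least `1/2`. -/
theorem half_le_bathEigenvalue {α : Fin N → ℕ} (hα : α ≠ 0) : 1 / 2 ≤ bathEigenvalue α := by
  obtain ⟨j, hj⟩ := Function.ne_iff.1 hα
  have h := Finset.single_le_sum (f := fun j => 1 - cosMoment (α j))
    (fun i _ => sub_nonneg.2 (cosMoment_le_one (α i))) (Finset.mem_univ j)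
  have := cosMoment_le_half hj
  unfold bathEigenvalue
  linarith

theorem bathEigenvalue_single_two (j : Fin N) : bathEigenvalue (Pi.single j 2) = 1 / 2 := by
  rw [bathEigenvalue, Fintype.sum_eq_single j]
  · rw [Pi.single_eq_same, cosMoment_two]; norm_num
  · intro k hk
    rw [Pi.single_eq_of_ne hk, cosMoment_zero, sub_self]

theorem eq_single_two_of_bathEigenvalue {α : Fin N → ℕ} (h : bathEigenvalue α = 1 / 2) :
    ∃ j, α = Pi.single j 2 := by
  have hα : α ≠ 0 := by
    rintro rfl
    simp [bathEigenvalue, cosMoment_zero] at h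
  obtain ⟨j, hj⟩ := Function.ne_iff.1 hα
  have hnn : ∀ i, 0 ≤ 1 - cosMoment (α i) := fun i => sub_nonneg.2 (cosMoment_le_one (α i))
  have hsplit := Finset.add_sum_erase Finset.univ (fun j => 1 - cosMoment (α j))
    (Finset.mem_univ j)
  have hj' := cosMoment_le_half hj
  rw [bathEigenvalue] at h
  -- A second nonzero entry would raise the eigenvalue to at least `1`.
  have hother : ∀ k, k ≠ j → α k = 0 := by
    intro k hk
    by_contra hk0
    have h1 := Finset.single_le_sum (s := Finset.univ.erase j)
      (f := fun j => 1 - cosMoment (α j)) (fun i _ => hnn i)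
      (Finset.mem_erase.2 ⟨hk, Finset.mem_univ k⟩)
    have h2 := cosMoment_le_half hk0
    linarith
  have h0 : ∑ k ∈ Finset.univ.erase j, (1 - cosMoment (α k)) = 0 :=
    Finset.sum_eq_zero fun k hk => by
      rw [hother k (Finset.ne_of_mem_erase hk), cosMoment_zero, sub_self]
  have hj2 : α j = 2 := cosMoment_eq_half (by linarith)
  refine ⟨j, funext fun k => ?_⟩
  rcases eq_or_ne k j with rfl | hk
  · rw [hj2, Pi.single_eq_same]
  · rw [hother k hk, Pi.single_eq_of_ne hk]

/-- For fixed `θ` the collision is moved from `h` onto the Hermite product, where it becomes one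
with angle `-θ`. Mehler's identity then yields `cos (-θ) ^ α j = cos θ ^ α j`. -/
theorem integral_hermiteProd_mul_bathT {β : ℝ} (hβ : 0 < β) (j : Fin N) (α : Fin N → ℕ)
    {h : (Fin N → ℝ) → ℝ} (hh : MemLp h 2 (Measure.pi fun _ => oneMeasure β)) :
    ∫ v, hermiteProd β α v * bathT β j h v ∂(Measure.pi fun _ => oneMeasure β)
      = cosMoment (α j)
        * ∫ v, hermiteProd β α v * h v ∂(Measure.pi fun _ => oneMeasure β) := by
  set γ := Measure.pi fun _ : Fin N => oneMeasure β with hγ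
  have hα : MemLp (hermiteProd β α) 2 γ := memLp_hermiteProd hβ α
  have hP := measurePreserving_bathCollision_prod β j
  have hA := measurePreserving_prodAssoc γ (oneMeasure β) angleMeasure
  have hint := integrable_mul_comp hP hh hα
  have hint' := hA.integrable_comp_of_integrable hint
  have hθ : ∀ θ : ℝ, ∫ p : (Fin N → ℝ) × ℝ, hermiteProd β α p.1 * h (bathCollision j θ p.2 p.1)
      ∂(γ.prod (oneMeasure β)) = cos θ ^ α j * ∫ v, hermiteProd β α v * h v ∂γ := by
    intro θ
    rw [integral_mul_bathCollision β j θ hh.1 hα.1, integral_prod]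
    · simp only [integral_mul_const]
      simp_rw [integral_hermiteProd_bathCollision hβ, cos_neg, mul_assoc]
      rw [integral_const_mul]
    · exact (hα.comp_measurePreserving (measurePreserving_bathCollision β j (-θ))).integrable_mul
        (hh.comp_measurePreserving measurePreserving_fst)
  have e1 : ∫ v, hermiteProd β α v * bathT β j h v ∂γ
      = ∫ v, hermiteProd β α v * bathAverage β j h v ∂γ := by
    refine integral_congr_ae ?_
    filter_upwards [bathT_ae_eq_bathAverage hβ j hh] with v hv
    rw [hv]
  rw [e1]
  unfold bathAverage
  rw [integral_mul_average hP hh hα, ← integral_comp_measurePreserving hA hint.1]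
  -- The angle is made the outermost variable, so that the identity for fixed `θ` applies.
  refine Eq.trans (integral_prod_symm (fun p : ((Fin N → ℝ) × ℝ) × ℝ =>
      hermiteProd β α p.1.1 * h (bathCollision j p.2 p.1.2 p.1.1)) hint') ?_
  refine Eq.trans (integral_congr_ae (Filter.Eventually.of_forall hθ)) ?_
  rw [integral_mul_const, cosMoment]

theorem integral_mul_bathGenerator {β : ℝ} (hβ : 0 < β) {h k : (Fin N → ℝ) → ℝ}
    (hh : MemLp h 2 (Measure.pi fun _ => oneMeasure β))
    (hk : MemLp k 2 (Measure.pi fun _ => oneMeasure β)) :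
    ∫ v, k v * bathGenerator β h v ∂(Measure.pi fun _ => oneMeasure β)
      = ∑ j, (∫ v, k v * h v ∂(Measure.pi fun _ => oneMeasure β)
        - ∫ v, k v * bathT β j h v ∂(Measure.pi fun _ => oneMeasure β)) := by
  have i1 : Integrable (fun v => k v * h v) (Measure.pi fun _ => oneMeasure β) :=
    hk.integrable_mul hh
  have i2 : ∀ j, Integrable (fun v => k v * bathT β j h v) (Measure.pi fun _ => oneMeasure β) :=
    fun j => hk.integrable_mul (memLp_bathT hβ j hh)
  simp only [bathGenerator, Finset.mul_sum, mul_sub]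
  have i3 : ∀ j, Integrable (fun v => k v * h v - k v * bathT β j h v)
      (Measure.pi fun _ => oneMeasure β) := fun j => i1.sub (i2 j)
  rw [integral_finsetSum _ fun j _ => i3 j]
  exact Finset.sum_congr rfl fun j _ => integral_sub i1 (i2 j)

theorem integral_hermiteProd_mul_bathGenerator {β : ℝ} (hβ : 0 < β) (α : Fin N → ℕ)
    {h : (Fin N → ℝ) → ℝ} (hh : MemLp h 2 (Measure.pi fun _ => oneMeasure β)) :
    ∫ v, hermiteProd β α v * bathGenerator β h v ∂(Measure.pi fun _ => oneMeasure β)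
      = bathEigenvalue α
        * ∫ v, hermiteProd β α v * h v ∂(Measure.pi fun _ => oneMeasure β) := by
  rw [integral_mul_bathGenerator hβ hh (memLp_hermiteProd hβ α), bathEigenvalue, Finset.sum_mul]
  refine Finset.sum_congr rfl fun j _ => ?_
  rw [integral_hermiteProd_mul_bathT hβ j α hh]
  ring

/-- Square integrable functions with equal Hermite coefficients agree almost everywhere. -/
theorem ae_eq_of_integral_hermiteProd {β : ℝ} (hβ : 0 < β) {f g : (Fin N → ℝ) → ℝ}
    (hf : MemLp f 2 (Measure.pi fun _ => oneMeasure β))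
    (hg : MemLp g 2 (Measure.pi fun _ => oneMeasure β))
    (h0 : ∀ α, ∫ v, hermiteProd β α v * f v ∂(Measure.pi fun _ => oneMeasure β)
      = ∫ v, hermiteProd β α v * g v ∂(Measure.pi fun _ => oneMeasure β)) :
    f =ᵐ[Measure.pi fun _ => oneMeasure β] g := by
  have h := ae_eq_zero_of_integral_hermiteProd hβ (hf.sub hg) fun α => by
    simp only [Pi.sub_apply, mul_sub]
    rw [integral_sub (f := fun v => hermiteProd β α v * f v)
      (g := fun v => hermiteProd β α v * g v) ((memLp_hermiteProd hβ α).integrable_mul hf)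
      ((memLp_hermiteProd hβ α).integrable_mul hg), h0, sub_self]
  filter_upwards [h] with v hv
  simpa [sub_eq_zero] using hv

/-! ### Parseval's identity and the gap of the bath operator -/

/-- The normalization constants of the Hermite functions. -/
def hermiteNorm (α : Fin N → ℕ) : ℝ := √(∏ k, ((α k).factorial : ℝ))

theorem hermiteNorm_pos (α : Fin N → ℕ) : 0 < hermiteNorm α :=
  Real.sqrt_pos.2 (Finset.prod_pos fun _ _ => Nat.cast_pos.2 (Nat.factorial_pos _))

theorem hermiteNorm_sq (α : Fin N → ℕ) :
    hermiteNorm α * hermiteNorm α = ∏ k, ((α k).factorial : ℝ) :=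
  Real.mul_self_sqrt (Finset.prod_nonneg fun _ _ => Nat.cast_nonneg _)

/-- The Hermite coefficients of a function. -/
def hermiteCoeff (β : ℝ) (h : (Fin N → ℝ) → ℝ) (α : Fin N → ℕ) : ℝ :=
  (hermiteNorm α)⁻¹ * ∫ v, hermiteProd β α v * h v ∂(Measure.pi fun _ => oneMeasure β)

theorem inner_toLp_eq_integral {X : Type*} [MeasurableSpace X] {P : Measure X} {f g : X → ℝ}
    (hf : MemLp f 2 P) (hg : MemLp g 2 P) :
    inner ℝ (hf.toLp f) (hg.toLp g) = ∫ x, f x * g x ∂P := by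
  rw [L2.inner_def]
  refine integral_congr_ae ?_
  filter_upwards [hf.coeFn_toLp, hg.coeFn_toLp] with x h1 h2
  rw [h1, h2]
  simp [mul_comm]

/-- The Hermite functions in `L²`, normalized. -/
def hermiteLp {β : ℝ} (hβ : 0 < β) (α : Fin N → ℕ) :
    Lp ℝ 2 (Measure.pi fun _ : Fin N => oneMeasure β) :=
  (hermiteNorm α)⁻¹ • (memLp_hermiteProd hβ α).toLp _

theorem inner_hermiteLp_toLp {β : ℝ} (hβ : 0 < β) (α : Fin N → ℕ) {h : (Fin N → ℝ) → ℝ}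
    (hh : MemLp h 2 (Measure.pi fun _ => oneMeasure β)) :
    inner ℝ (hermiteLp hβ α) (hh.toLp h) = hermiteCoeff β h α := by
  rw [hermiteLp, real_inner_smul_left, inner_toLp_eq_integral, hermiteCoeff]

theorem orthonormal_hermiteLp {β : ℝ} (hβ : 0 < β) :
    Orthonormal ℝ (hermiteLp (N := N) hβ) := by
  rw [orthonormal_iff_ite]
  intro α α'
  rw [hermiteLp, hermiteLp, real_inner_smul_left, real_inner_smul_right, inner_toLp_eq_integral,
    integral_hermiteProd_mul hβ]
  split_ifs with h
  · subst h
    have := (hermiteNorm_pos α).ne'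
    rw [← hermiteNorm_sq]
    field_simp
  · simp

theorem span_hermiteLp_orthogonal {β : ℝ} (hβ : 0 < β) :
    (Submodule.span ℝ (Set.range (hermiteLp (N := N) hβ)))ᗮ = ⊥ := by
  rw [Submodule.eq_bot_iff]
  intro x hx
  have hm := Lp.memLp x
  have hx' : hm.toLp x = x := Lp.toLp_coeFn x hm
  have h0 := ae_eq_zero_of_integral_hermiteProd hβ hm fun α => by
    have h1 := (Submodule.mem_orthogonal _ _).1 hx (hermiteLp hβ α)
      (Submodule.subset_span ⟨α, rfl⟩)
    rw [← hx', inner_hermiteLp_toLp, hermiteCoeff] at h1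
    exact (mul_eq_zero.1 h1).resolve_left (inv_ne_zero (hermiteNorm_pos α).ne')
  exact Lp.eq_zero_iff_ae_eq_zero.2 h0

/-- Parseval's identity for the Hermite coefficients. -/
theorem hasSum_hermiteCoeff_mul {β : ℝ} (hβ : 0 < β) {f g : (Fin N → ℝ) → ℝ}
    (hf : MemLp f 2 (Measure.pi fun _ => oneMeasure β))
    (hg : MemLp g 2 (Measure.pi fun _ => oneMeasure β)) :
    HasSum (fun α => hermiteCoeff β f α * hermiteCoeff β g α)
      (∫ v, f v * g v ∂(Measure.pi fun _ => oneMeasure β)) := by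
  let b := HilbertBasis.mkOfOrthogonalEqBot (orthonormal_hermiteLp hβ)
    (span_hermiteLp_orthogonal (N := N) hβ)
  have h := b.hasSum_inner_mul_inner (hf.toLp f) (hg.toLp g)
  have hb : ∀ α, b α = hermiteLp hβ α := fun α => by
    simp only [b, HilbertBasis.coe_mkOfOrthogonalEqBot]
  rw [inner_toLp_eq_integral] at h
  simpa only [hb, inner_hermiteLp_toLp, real_inner_comm (hermiteLp hβ _) (hf.toLp f)] using h

theorem hermiteCoeff_bathGenerator {β : ℝ} (hβ : 0 < β) {h : (Fin N → ℝ) → ℝ}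
    (hh : MemLp h 2 (Measure.pi fun _ => oneMeasure β)) (α : Fin N → ℕ) :
    hermiteCoeff β (bathGenerator β h) α = bathEigenvalue α * hermiteCoeff β h α := by
  rw [hermiteCoeff, hermiteCoeff, integral_hermiteProd_mul_bathGenerator hβ α hh]
  ring

theorem hermiteCoeff_zero (β : ℝ) (h : (Fin N → ℝ) → ℝ) :
    hermiteCoeff β h 0 = ∫ v, h v ∂(Measure.pi fun _ => oneMeasure β) := by
  simp [hermiteCoeff, hermiteNorm, hermiteProd_zero]

/-- The defect in the gap inequality as an explicit series: both the inequality and its case of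
equality are read off from the signs of the terms. -/
theorem hasSum_bathGenerator_sub {β : ℝ} (hβ : 0 < β) {h : (Fin N → ℝ) → ℝ}
    (hh : MemLp h 2 (Measure.pi fun _ => oneMeasure β)) :
    HasSum (fun α => (bathEigenvalue α - 1 / 2) * hermiteCoeff β h α ^ 2)
      (∫ v, h v * bathGenerator β h v ∂(Measure.pi fun _ => oneMeasure β)
        - 1 / 2 * ∫ v, h v * h v ∂(Measure.pi fun _ => oneMeasure β)) := by
  have h1 := hasSum_hermiteCoeff_mul hβ hh (memLp_bathGenerator hβ hh)
  have h2 := (hasSum_hermiteCoeff_mul hβ hh hh).mul_left (1 / 2)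
  refine (h1.sub h2).congr_fun ?_
  intro α
  simp only [hermiteCoeff_bathGenerator hβ hh]
  ring

theorem bathGenerator_term_nonneg {β : ℝ} {h : (Fin N → ℝ) → ℝ}
    (h0 : ∫ v, h v ∂(Measure.pi fun _ => oneMeasure β) = 0) (α : Fin N → ℕ) :
    0 ≤ (bathEigenvalue α - 1 / 2) * hermiteCoeff β h α ^ 2 := by
  rcases eq_or_ne α 0 with rfl | hα
  -- The factor is negative only at `α = 0`, where the coefficient is the mean of `h`.
  · rw [hermiteCoeff_zero, h0]; simp
  · exact mul_nonneg (sub_nonneg.2 (half_le_bathEigenvalue hα)) (sq_nonneg _)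

/-- The spectral gap of the bath part of the generator. -/
theorem half_mul_le_integral_mul_bathGenerator {β : ℝ} (hβ : 0 < β) {h : (Fin N → ℝ) → ℝ}
    (hh : MemLp h 2 (Measure.pi fun _ => oneMeasure β))
    (h0 : ∫ v, h v ∂(Measure.pi fun _ => oneMeasure β) = 0) :
    1 / 2 * ∫ v, h v * h v ∂(Measure.pi fun _ => oneMeasure β)
      ≤ ∫ v, h v * bathGenerator β h v ∂(Measure.pi fun _ => oneMeasure β) :=
  sub_nonneg.1 ((hasSum_bathGenerator_sub hβ hh).nonneg (bathGenerator_term_nonneg h0))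

/-- In the case of equality in the spectral gap inequality of the bath, the Hermite expansion has
only the terms of eigenvalue `1/2`. -/
theorem integral_hermiteProd_mul_eq_zero_of_equality {β : ℝ} (hβ : 0 < β) {h : (Fin N → ℝ) → ℝ}
    (hh : MemLp h 2 (Measure.pi fun _ => oneMeasure β))
    (h0 : ∫ v, h v ∂(Measure.pi fun _ => oneMeasure β) = 0)
    (heq : ∫ v, h v * bathGenerator β h v ∂(Measure.pi fun _ => oneMeasure β)
      ≤ 1 / 2 * ∫ v, h v * h v ∂(Measure.pi fun _ => oneMeasure β))
    {α : Fin N → ℕ} (hα : bathEigenvalue α ≠ 1 / 2) :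
    ∫ v, hermiteProd β α v * h v ∂(Measure.pi fun _ => oneMeasure β) = 0 := by
  have hs := hasSum_bathGenerator_sub hβ hh
  have hle := le_hasSum hs α fun α' _ => bathGenerator_term_nonneg h0 α'
  have hz : (bathEigenvalue α - 1 / 2) * hermiteCoeff β h α ^ 2 = 0 :=
    le_antisymm (hle.trans (sub_nonpos.2 heq)) (bathGenerator_term_nonneg h0 α)
  have hc : hermiteCoeff β h α = 0 :=
    pow_eq_zero_iff two_ne_zero |>.1 ((mul_eq_zero.1 hz).resolve_left (sub_ne_zero.2 hα))
  exact (mul_eq_zero.1 hc).resolve_left (inv_ne_zero (hermiteNorm_pos α).ne')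

theorem bathGenerator_ae_eq_half {β : ℝ} (hβ : 0 < β) {h : (Fin N → ℝ) → ℝ}
    (hh : MemLp h 2 (Measure.pi fun _ => oneMeasure β))
    (hc : ∀ α, bathEigenvalue α ≠ 1 / 2 →
      ∫ v, hermiteProd β α v * h v ∂(Measure.pi fun _ => oneMeasure β) = 0) :
    bathGenerator β h =ᵐ[Measure.pi fun _ => oneMeasure β] fun v => 1 / 2 * h v := by
  refine ae_eq_of_integral_hermiteProd hβ (memLp_bathGenerator hβ hh) (hh.const_mul _) fun α => ?_
  rw [integral_hermiteProd_mul_bathGenerator hβ α hh]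
  simp only [mul_left_comm _ (1 / 2 : ℝ)]
  rw [integral_const_mul]
  by_cases hα : bathEigenvalue α = 1 / 2
  · rw [hα]
  · rw [hc α hα]; simp

/-! ### The quadratic eigenspace of the bath and the action of `Q` on it -/

/-- The quadratic functions `∑ⱼ cⱼ (vⱼ² - 1/β)`. -/
def quadraticFun (β : ℝ) (c : Fin N → ℝ) (v : Fin N → ℝ) : ℝ := ∑ j, c j * (v j ^ 2 - 1 / β)

theorem gapFunction_eq_quadraticFun (β : ℝ) : gapFunction N β = quadraticFun β 1 := by
  funext v; simp [gapFunction, quadraticFun]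

theorem quadraticFun_eq_hermiteProd {β : ℝ} (hβ : 0 < β) (c : Fin N → ℝ) (v : Fin N → ℝ) :
    quadraticFun β c v = ∑ j, β⁻¹ * c j * hermiteProd β (Pi.single j 2) v := by
  refine Finset.sum_congr rfl fun j _ => ?_
  rw [hermiteProd_single_two hβ]
  field_simp

theorem memLp_quadraticFun {β : ℝ} (hβ : 0 < β) (c : Fin N → ℝ) :
    MemLp (quadraticFun β c) 2 (Measure.pi fun _ => oneMeasure β) := by
  rw [funext (quadraticFun_eq_hermiteProd hβ c)]
  exact memLp_finsetSum _ fun j _ => (memLp_hermiteProd hβ _).const_mul _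

theorem integral_hermiteProd_mul_quadraticFun {β : ℝ} (hβ : 0 < β) (c : Fin N → ℝ)
    (α : Fin N → ℕ) :
    ∫ v, hermiteProd β α v * quadraticFun β c v ∂(Measure.pi fun _ => oneMeasure β)
      = ∑ j, β⁻¹ * c j * if α = Pi.single j 2 then ∏ k, ((α k).factorial : ℝ) else 0 := by
  have e : ∀ v, hermiteProd β α v * quadraticFun β c v
      = ∑ j, β⁻¹ * c j * (hermiteProd β α v * hermiteProd β (Pi.single j 2) v) := by
    intro v
    rw [quadraticFun_eq_hermiteProd hβ, Finset.mul_sum]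
    exact Finset.sum_congr rfl fun j _ => by ring
  have hi : ∀ j : Fin N, Integrable
      (fun v => β⁻¹ * c j * (hermiteProd β α v * hermiteProd β (Pi.single j 2) v))
      (Measure.pi fun _ => oneMeasure β) := fun j =>
    ((memLp_hermiteProd hβ α).integrable_mul (memLp_hermiteProd hβ _)).const_mul _
  simp_rw [e]
  rw [integral_finsetSum _ fun j _ => hi j]
  simp only [integral_const_mul, integral_hermiteProd_mul hβ]

theorem integral_hermiteProd_mul_quadraticFun_eq_zero {β : ℝ} (hβ : 0 < β) (c : Fin N → ℝ)
    {α : Fin N → ℕ} (hα : bathEigenvalue α ≠ 1 / 2) :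
    ∫ v, hermiteProd β α v * quadraticFun β c v ∂(Measure.pi fun _ => oneMeasure β) = 0 := by
  rw [integral_hermiteProd_mul_quadraticFun hβ]
  refine Finset.sum_eq_zero fun j _ => ?_
  rw [if_neg, mul_zero]
  rintro rfl
  exact hα (bathEigenvalue_single_two j)

/-- The `2` is `2!`, the squared norm of the Hermite product; `β⁻¹` comes from `vᵢ² - 1/β = β⁻¹ H₂`.
-/
theorem integral_hermiteProd_single_mul_quadraticFun {β : ℝ} (hβ : 0 < β) (c : Fin N → ℝ)
    (i : Fin N) :
    ∫ v, hermiteProd β (Pi.single i 2) v * quadraticFun β c v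
      ∂(Measure.pi fun _ => oneMeasure β) = 2 * β⁻¹ * c i := by
  rw [integral_hermiteProd_mul_quadraticFun hβ, Fintype.sum_eq_single i]
  · rw [if_pos rfl, Fintype.prod_eq_single i]
    · simp; ring
    · intro k hk; simp [Pi.single_eq_of_ne hk]
  · intro k hk
    rw [if_neg, mul_zero]
    intro h
    have := congrFun h k
    rw [Pi.single_eq_same, Pi.single_eq_of_ne hk] at this
    omega

theorem integral_quadraticFun {β : ℝ} (hβ : 0 < β) (c : Fin N → ℝ) :
    ∫ v, quadraticFun β c v ∂(Measure.pi fun _ => oneMeasure β) = 0 := by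
  have h := integral_hermiteProd_mul_quadraticFun_eq_zero hβ c (α := 0)
    (by simp [bathEigenvalue, cosMoment_zero])
  simpa [hermiteProd_zero] using h

/-- A rotation preserves `vᵢ² + vⱼ²`, so only the difference of the two coefficients is felt; with
equal coefficients the function is invariant. -/
theorem quadraticFun_pairCollision (β : ℝ) (c : Fin N → ℝ) {i j : Fin N} (hij : i ≠ j) (θ : ℝ)
    (v : Fin N → ℝ) :
    quadraticFun β c (pairCollision i j θ v) = quadraticFun β c v
      + (c i - c j) * ((v j ^ 2 - v i ^ 2) * sin θ ^ 2 + 2 * v i * v j * (sin θ * cos θ)) := by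
  rw [← sub_eq_iff_eq_add', quadraticFun, quadraticFun, ← Finset.sum_sub_distrib,
    Fintype.sum_eq_add i j hij]
  · simp only [pairCollision, Function.update_apply, if_neg hij, if_true]
    linear_combination
      (c i * v i ^ 2 + c j * v j ^ 2) * sin_sq_add_cos_sq θ
  · rintro k ⟨hki, hkj⟩
    simp [pairCollision, hki, hkj]

theorem pairAverage_quadraticFun {β : ℝ} (hβ : 0 < β) (c : Fin N → ℝ) {i j : Fin N} (hij : i ≠ j)
    (v : Fin N → ℝ) :
    pairAverage i j (quadraticFun β c) v = quadraticFun β c v + (c i - c j) / 2 * β⁻¹ *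
      (hermiteProd β (Pi.single j 2) v - hermiteProd β (Pi.single i 2) v) := by
  have hpi : (2 * π) ≠ 0 := by positivity
  have ii : ∀ f : ℝ → ℝ, Continuous f → IntervalIntegrable f volume 0 (2 * π) :=
    fun f hf => hf.intervalIntegrable _ _
  simp only [pairAverage, quadraticFun_pairCollision β c hij]
  rw [integral_angleMeasure, intervalIntegral.integral_add (ii _ (by fun_prop))
    (ii _ (by fun_prop)), intervalIntegral.integral_const_mul,
    intervalIntegral.integral_add (ii _ (by fun_prop)) (ii _ (by fun_prop)),
    intervalIntegral.integral_const_mul, intervalIntegral.integral_const_mul,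
    intervalIntegral.integral_const, integral_sin_sq, integral_sin_mul_cos₁,
    hermiteProd_single_two hβ, hermiteProd_single_two hβ]
  simp
  field_simp
  ring

/-- The defect of each pair is an exact square, so a vanishing total defect makes all coefficients
equal. -/
theorem integral_mul_pairAverage_quadraticFun {β : ℝ} (hβ : 0 < β) (c : Fin N → ℝ) {i j : Fin N}
    (hij : i ≠ j) :
    ∫ v, quadraticFun β c v * pairAverage i j (quadraticFun β c) v
        ∂(Measure.pi fun _ => oneMeasure β)
      = ∫ v, quadraticFun β c v * quadraticFun β c v ∂(Measure.pi fun _ => oneMeasure β)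
        - (β⁻¹ * (c i - c j)) ^ 2 := by
  have hq := memLp_quadraticFun hβ c
  have hH := fun k : Fin N => memLp_hermiteProd hβ (Pi.single k 2)
  have i1 : Integrable (fun v => quadraticFun β c v * quadraticFun β c v)
    (Measure.pi fun _ => oneMeasure β) := hq.integrable_mul hq
  have i2 : ∀ k : Fin N, Integrable
      (fun v => hermiteProd β (Pi.single k 2) v * quadraticFun β c v)
      (Measure.pi fun _ => oneMeasure β) := fun k => (hH k).integrable_mul hq
  have i3 : Integrable (fun v => (c i - c j) / 2 * β⁻¹ *
      (hermiteProd β (Pi.single j 2) v * quadraticFun β c v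
        - hermiteProd β (Pi.single i 2) v * quadraticFun β c v))
      (Measure.pi fun _ => oneMeasure β) := ((i2 j).sub (i2 i)).const_mul _
  have e : ∀ v, quadraticFun β c v * pairAverage i j (quadraticFun β c) v
      = quadraticFun β c v * quadraticFun β c v + (c i - c j) / 2 * β⁻¹ *
        (hermiteProd β (Pi.single j 2) v * quadraticFun β c v
          - hermiteProd β (Pi.single i 2) v * quadraticFun β c v) := by
    intro v
    rw [pairAverage_quadraticFun hβ c hij]
    ring
  simp_rw [e]
  rw [integral_add i1 i3, integral_const_mul, integral_sub (i2 j) (i2 i),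
    integral_hermiteProd_single_mul_quadraticFun hβ, integral_hermiteProd_single_mul_quadraticFun hβ]
  ring

/-- Invariance of a quadratic function under `Q` forces its coefficients to be equal. -/
theorem coeff_eq_of_integral_mul_kacQ {β : ℝ} (hβ : 0 < β) (hN : 2 ≤ N) (c : Fin N → ℝ)
    (hle : ∫ v, quadraticFun β c v * quadraticFun β c v ∂(Measure.pi fun _ => oneMeasure β)
      ≤ ∫ v, quadraticFun β c v * kacQ (quadraticFun β c) v
        ∂(Measure.pi fun _ => oneMeasure β)) (i j : Fin N) : c i = c j := by
  have hc := choose_two_pos hN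
  have hq := memLp_quadraticFun hβ c
  rw [integral_mul_kacQ hq hq, one_div, le_inv_mul_iff₀ hc, ← sum_card_pairs] at hle
  have hsum : ∑ i : Fin N, ∑ j ∈ Finset.Ioi i, (β⁻¹ * (c i - c j)) ^ 2 ≤ 0 := by
    have e : ∑ i : Fin N, ∑ j ∈ Finset.Ioi i,
        ∫ v, quadraticFun β c v * pairAverage i j (quadraticFun β c) v
          ∂(Measure.pi fun _ => oneMeasure β)
        = ∑ i : Fin N, ∑ j ∈ Finset.Ioi i,
          (∫ v, quadraticFun β c v * quadraticFun β c v ∂(Measure.pi fun _ => oneMeasure β)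
            - (β⁻¹ * (c i - c j)) ^ 2) :=
      Finset.sum_congr rfl fun i _ => Finset.sum_congr rfl fun j hj =>
        integral_mul_pairAverage_quadraticFun hβ c (Finset.mem_Ioi.1 hj).ne
    rw [e] at hle
    simp only [Finset.sum_sub_distrib] at hle
    linarith
  have key : ∀ i j : Fin N, i < j → c i = c j := by
    intro i j hij
    have h1 : (β⁻¹ * (c i - c j)) ^ 2 ≤ 0 :=
      calc (β⁻¹ * (c i - c j)) ^ 2 ≤ ∑ j ∈ Finset.Ioi i, (β⁻¹ * (c i - c j)) ^ 2 :=
            Finset.single_le_sum (f := fun j => (β⁻¹ * (c i - c j)) ^ 2)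
              (fun _ _ => sq_nonneg _) (Finset.mem_Ioi.2 hij)
        _ ≤ ∑ i : Fin N, ∑ j ∈ Finset.Ioi i, (β⁻¹ * (c i - c j)) ^ 2 :=
            Finset.single_le_sum (f := fun i => ∑ j ∈ Finset.Ioi i, (β⁻¹ * (c i - c j)) ^ 2)
              (fun _ _ => Finset.sum_nonneg fun _ _ => sq_nonneg _) (Finset.mem_univ i)
        _ ≤ 0 := hsum
    have h2 := pow_eq_zero_iff two_ne_zero |>.1 (le_antisymm h1 (sq_nonneg _))
    exact sub_eq_zero.1 ((mul_eq_zero.1 h2).resolve_left (inv_pos.2 hβ).ne')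
  rcases lt_trichotomy i j with h | h | h
  · exact key i j h
  · rw [h]
  · exact (key j i h).symm

theorem ae_eq_quadraticFun {β : ℝ} (hβ : 0 < β) {h : (Fin N → ℝ) → ℝ}
    (hh : MemLp h 2 (Measure.pi fun _ => oneMeasure β))
    (hc : ∀ α, bathEigenvalue α ≠ 1 / 2 →
      ∫ v, hermiteProd β α v * h v ∂(Measure.pi fun _ => oneMeasure β) = 0) :
    ∃ c, h =ᵐ[Measure.pi fun _ => oneMeasure β] quadraticFun β c := by
  -- The factor `β / 2` inverts the constant in `integral_hermiteProd_single_mul_quadraticFun`.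
  refine ⟨fun j => β / 2 * ∫ v, hermiteProd β (Pi.single j 2) v * h v
    ∂(Measure.pi fun _ => oneMeasure β),
    ae_eq_of_integral_hermiteProd hβ hh (memLp_quadraticFun hβ _) fun α => ?_⟩
  by_cases hα : bathEigenvalue α = 1 / 2
  · obtain ⟨j, rfl⟩ := eq_single_two_of_bathEigenvalue hα
    rw [integral_hermiteProd_single_mul_quadraticFun hβ]
    field_simp
  · rw [hc α hα, integral_hermiteProd_mul_quadraticFun_eq_zero hβ _ hα]

theorem quadraticFun_const (β c : ℝ) (v : Fin N → ℝ) :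
    quadraticFun β (fun _ => c) v = c * gapFunction N β v := by
  rw [quadraticFun, gapFunction, Finset.mul_sum]

/-! ### The spectral gap of the generator and its eigenfunction -/

/-- The scalar `c` is carried along so that the normalized minimizer is covered without appeal to
linearity of the generator. -/
theorem generator_gapFunction {β : ℝ} (hβ : 0 < β) (hN : 2 ≤ N) (lam μ c : ℝ) :
    generator β lam μ (fun v => c * gapFunction N β v)
      =ᵐ[Measure.pi fun _ => oneMeasure β] fun v => μ / 2 * (c * gapFunction N β v) := by
  simp only [← quadraticFun_const]
  have hq := memLp_quadraticFun hβ (fun _ : Fin N => c)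
  filter_upwards [bathGenerator_ae_eq_half hβ hq fun α hα =>
    integral_hermiteProd_mul_quadraticFun_eq_zero hβ _ hα] with v hv
  have hQ := kacQ_eq_self hN (h := quadraticFun β fun _ => c) (fun i j θ v hij => by
    rw [quadraticFun_pairCollision β _ hij]; ring) v
  rw [generator_eq, hQ, hv]
  ring

/-- `Q` and the `T_j` preserve the mean. Consequently an eigenfunction with nonzero eigenvalue is
automatically orthogonal to the constants. -/
theorem integral_generator {β : ℝ} (hβ : 0 < β) (hN : 2 ≤ N) (lam μ : ℝ) {h : (Fin N → ℝ) → ℝ}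
    (hh : MemLp h 2 (Measure.pi fun _ => oneMeasure β)) :
    ∫ v, generator β lam μ h v ∂(Measure.pi fun _ => oneMeasure β) = 0 := by
  have h1 := integral_mul_generator hβ lam μ hh (memLp_const (1 : ℝ))
  have h2 := integral_hermiteProd_mul_bathGenerator hβ 0 hh
  simp only [one_mul, hermiteProd_zero] at h1 h2
  rw [h1, integral_kacQ hN hh, h2]
  simp [bathEigenvalue, cosMoment_zero]

theorem gammaInner_eq {β : ℝ} (hβ : 0 < β) (h k : (Fin N → ℝ) → ℝ) :
    gammaInner β h k = ∫ v, h v * k v ∂(Measure.pi fun _ => oneMeasure β) := by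
  rw [gammaInner, gammaMeasure_eq_pi N hβ]

theorem not_gapFunction_ae_eq_zero {β : ℝ} (hβ : 0 < β) (hN : 2 ≤ N) :
    ¬ gapFunction N β =ᵐ[Measure.pi fun _ => oneMeasure β] 0 := by
  intro h
  have h1 := integral_hermiteProd_single_mul_quadraticFun hβ 1 (⟨0, by omega⟩ : Fin N)
  rw [← gapFunction_eq_quadraticFun] at h1
  have h2 : ∫ v, hermiteProd β (Pi.single (⟨0, by omega⟩ : Fin N) 2) v * gapFunction N β v
      ∂(Measure.pi fun _ => oneMeasure β) = 0 := by
    refine integral_eq_zero_of_ae ?_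
    filter_upwards [h] with v hv
    rw [hv]; simp
  rw [h2] at h1
  simp [hβ.ne'] at h1

theorem half_mul_le_integral_mul_generator {β lam μ : ℝ} (hβ : 0 < β) (hN : 2 ≤ N)
    (hlam : 0 ≤ lam) (hμ : 0 ≤ μ) {h : (Fin N → ℝ) → ℝ}
    (hh : MemLp h 2 (Measure.pi fun _ => oneMeasure β))
    (h0 : ∫ v, h v ∂(Measure.pi fun _ => oneMeasure β) = 0) :
    μ / 2 * ∫ v, h v * h v ∂(Measure.pi fun _ => oneMeasure β)
      ≤ ∫ v, h v * generator β lam μ h v ∂(Measure.pi fun _ => oneMeasure β) := by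
  rw [integral_mul_generator hβ lam μ hh hh]
  have h1 := mul_nonneg (mul_nonneg hlam (Nat.cast_nonneg N))
    (sub_nonneg.2 (integral_mul_kacQ_self_le (β := β) hN hh))
  have h2 := mul_le_mul_of_nonneg_left (half_mul_le_integral_mul_bathGenerator hβ hh h0) hμ
  linarith

theorem isLeast_spectralGap {β lam μ : ℝ} (hβ : 0 < β) (hN : 2 ≤ N)
    (hlam : 0 ≤ lam) (hμ : 0 ≤ μ) :
    IsLeast { r : ℝ | ∃ h : (Fin N → ℝ) → ℝ, MemLp h 2 (gammaMeasure N β) ∧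
      gammaNorm β h = 1 ∧ gammaInner β h (fun _ => 1) = 0 ∧
      r = |gammaInner β h (generator β lam μ h)| } (μ / 2) := by
  constructor
  · have hG : MemLp (gapFunction N β) 2 (Measure.pi fun _ => oneMeasure β) := by
      rw [gapFunction_eq_quadraticFun]; exact memLp_quadraticFun hβ _
    set I := ∫ v, gapFunction N β v * gapFunction N β v ∂(Measure.pi fun _ => oneMeasure β) with hI
    have hI0 : 0 ≤ I := integral_nonneg fun v => mul_self_nonneg _
    have hI1 : I ≠ 0 := by
      intro h
      rw [hI, integral_eq_zero_iff_of_nonneg (fun v => mul_self_nonneg _)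
        (hG.integrable_mul hG)] at h
      refine not_gapFunction_ae_eq_zero hβ hN ?_
      filter_upwards [h] with v hv
      exact mul_self_eq_zero.1 hv
    have hs : √I ≠ 0 := (Real.sqrt_pos.2 (lt_of_le_of_ne hI0 hI1.symm)).ne'
    have hnorm : ∫ v, ((√I)⁻¹ * gapFunction N β v) * ((√I)⁻¹ * gapFunction N β v)
        ∂(Measure.pi fun _ => oneMeasure β) = 1 := by
      have e : ∀ v, ((√I)⁻¹ * gapFunction N β v) * ((√I)⁻¹ * gapFunction N β v)
          = (√I)⁻¹ * (√I)⁻¹ * (gapFunction N β v * gapFunction N β v) := fun v => by ring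
      simp_rw [e]
      rw [integral_const_mul, ← hI, ← mul_inv, Real.mul_self_sqrt hI0, inv_mul_cancel₀ hI1]
    refine ⟨fun v => (√I)⁻¹ * gapFunction N β v, ?_, ?_, ?_, ?_⟩
    · rw [gammaMeasure_eq_pi N hβ]; exact hG.const_mul _
    · rw [gammaNorm, gammaInner_eq hβ, hnorm, Real.sqrt_one]
    · rw [gammaInner_eq hβ]
      simp only [mul_one]
      rw [integral_const_mul, gapFunction_eq_quadraticFun, integral_quadraticFun hβ, mul_zero]
    · rw [gammaInner_eq hβ]
      have e : ∫ v, (√I)⁻¹ * gapFunction N β v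
            * generator β lam μ (fun v => (√I)⁻¹ * gapFunction N β v) v
            ∂(Measure.pi fun _ => oneMeasure β)
          = ∫ v, μ / 2 * (((√I)⁻¹ * gapFunction N β v) * ((√I)⁻¹ * gapFunction N β v))
            ∂(Measure.pi fun _ => oneMeasure β) := by
        refine integral_congr_ae ?_
        filter_upwards [generator_gapFunction hβ hN lam μ (√I)⁻¹] with v hv
        rw [hv]; ring
      rw [e, integral_const_mul, hnorm, mul_one, abs_of_nonneg (by positivity)]
  · rintro r ⟨h, hh, hn, h0, rfl⟩
    rw [gammaMeasure_eq_pi N hβ] at hh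
    rw [gammaNorm, Real.sqrt_eq_one, gammaInner_eq hβ] at hn
    rw [gammaInner_eq hβ] at h0 ⊢
    simp only [mul_one] at h0
    have hle := half_mul_le_integral_mul_generator hβ hN hlam hμ hh h0
    rw [hn, mul_one] at hle
    exact hle.trans (le_abs_self _)

/-- Pairing the eigenvalue equation with `h` shows that the defects of `Q` and of the bath, with
positive weights `lam * N` and `μ`, sum to zero. Both therefore vanish: the bath defect makes `h`
quadratic, and the defect of `Q` equalizes its coefficients. -/
theorem eigenfunction_unique {β lam μ : ℝ} (hβ : 0 < β) (hN : 2 ≤ N) (hlam : 0 < lam) (hμ : 0 < μ)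
    {h : (Fin N → ℝ) → ℝ} (hh : MemLp h 2 (Measure.pi fun _ => oneMeasure β))
    (hE : generator β lam μ h =ᵐ[Measure.pi fun _ => oneMeasure β] fun v => μ / 2 * h v) :
    ∃ c : ℝ, h =ᵐ[Measure.pi fun _ => oneMeasure β] fun v => c * gapFunction N β v := by
  have hN0 : (0 : ℝ) < N := Nat.cast_pos.2 (by omega)
  have h0 : ∫ v, h v ∂(Measure.pi fun _ => oneMeasure β) = 0 := by
    have h1 := integral_generator hβ hN lam μ hh
    rw [integral_congr_ae hE, integral_const_mul] at h1
    exact (mul_eq_zero.1 h1).resolve_left (by positivity)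
  have h2 : ∫ v, h v * generator β lam μ h v ∂(Measure.pi fun _ => oneMeasure β)
      = μ / 2 * ∫ v, h v * h v ∂(Measure.pi fun _ => oneMeasure β) := by
    rw [← integral_const_mul]
    refine integral_congr_ae ?_
    filter_upwards [hE] with v hv
    rw [hv]; ring
  rw [integral_mul_generator hβ lam μ hh hh] at h2
  have hQ := sub_nonneg.2 (integral_mul_kacQ_self_le (β := β) hN hh)
  have hB := sub_nonneg.2 (half_mul_le_integral_mul_bathGenerator hβ hh h0)
  have hQ' := mul_nonneg (mul_pos hlam hN0).le hQ
  have hB' := mul_nonneg hμ.le hB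
  have hB0 : ∫ v, h v * bathGenerator β h v ∂(Measure.pi fun _ => oneMeasure β)
      - 1 / 2 * ∫ v, h v * h v ∂(Measure.pi fun _ => oneMeasure β) ≤ 0 :=
    nonpos_of_mul_nonpos_right (by linarith) hμ
  have hQ0 : ∫ v, h v * h v ∂(Measure.pi fun _ => oneMeasure β)
      - ∫ v, h v * kacQ h v ∂(Measure.pi fun _ => oneMeasure β) ≤ 0 :=
    nonpos_of_mul_nonpos_right (by linarith) (mul_pos hlam hN0)
  obtain ⟨c, hc⟩ := ae_eq_quadraticFun hβ hh fun α hα =>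
    integral_hermiteProd_mul_eq_zero_of_equality hβ hh h0 (sub_nonpos.1 hB0) hα
  have hcoef := coeff_eq_of_integral_mul_kacQ hβ hN c (by
    have e1 : ∫ v, h v * h v ∂(Measure.pi fun _ => oneMeasure β)
        = ∫ v, quadraticFun β c v * quadraticFun β c v ∂(Measure.pi fun _ => oneMeasure β) := by
      refine integral_congr_ae ?_
      filter_upwards [hc] with v hv
      rw [hv]
    have e2 : ∫ v, h v * kacQ h v ∂(Measure.pi fun _ => oneMeasure β)
        = ∫ v, quadraticFun β c v * kacQ (quadraticFun β c) v
          ∂(Measure.pi fun _ => oneMeasure β) := by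
      refine integral_congr_ae ?_
      filter_upwards [hc, kacQ_congr_ae hc] with v hv hv'
      rw [hv, hv']
    rw [← e1, ← e2]
    exact sub_nonpos.1 hQ0)
  have i0 : Fin N := ⟨0, by omega⟩
  refine ⟨c i0, hc.trans (Filter.Eventually.of_forall fun v => ?_)⟩
  simp only [← quadraticFun_const]
  rw [show c = fun _ => c i0 from funext fun j => hcoef j i0]

end KacThermostat

end

theorem proposition1 (N : ℕ) (hN : 2 ≤ N) (β lam μ : ℝ) (hβ : 0 < β) (hlam : 0 ≤ lam)
    (hμ : 0 ≤ μ) :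
    -- the generator is a well-defined operator on `L²(ℝ^N, γ dv)`
    (∀ h : (Fin N → ℝ) → ℝ, MemLp h 2 (KacThermostat.gammaMeasure N β) →
      MemLp (KacThermostat.generator β lam μ h) 2 (KacThermostat.gammaMeasure N β)) ∧
    (∀ h₁ h₂ : (Fin N → ℝ) → ℝ, MemLp h₁ 2 (KacThermostat.gammaMeasure N β) →
      h₁ =ᵐ[KacThermostat.gammaMeasure N β] h₂ →
      KacThermostat.generator β lam μ h₁ =ᵐ[KacThermostat.gammaMeasure N β]
        KacThermostat.generator β lam μ h₂) ∧
    -- the value of the spectral gap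
    KacThermostat.spectralGap N β lam μ = μ / 2 ∧
    -- the corresponding eigenfunction, which is orthogonal to the constants
    KacThermostat.IsEigenfunction β lam μ (μ / 2) (KacThermostat.gapFunction N β) ∧
    KacThermostat.gammaInner β (KacThermostat.gapFunction N β) (fun _ => 1) = 0 ∧
    -- it is the only one up to scalar multiples, if both interactions are present
    (0 < lam → 0 < μ → ∀ h : (Fin N → ℝ) → ℝ,
      KacThermostat.IsEigenfunction β lam μ (μ / 2) h →
      ∃ c : ℝ, h =ᵐ[KacThermostat.gammaMeasure N β]
        fun v => c * KacThermostat.gapFunction N β v) := by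
  refine ⟨?_, ?_, (KacThermostat.isLeast_spectralGap hβ hN hlam hμ).csInf_eq, ?_, ?_, ?_⟩
  · rw [KacThermostat.gammaMeasure_eq_pi N hβ]
    exact fun h hh => KacThermostat.memLp_generator hβ lam μ hh
  · rw [KacThermostat.gammaMeasure_eq_pi N hβ]
    exact fun h₁ h₂ hh hk => KacThermostat.generator_congr_ae hβ lam μ hh hk
  · rw [KacThermostat.IsEigenfunction, KacThermostat.gammaMeasure_eq_pi N hβ]
    refine ⟨?_, KacThermostat.not_gapFunction_ae_eq_zero hβ hN, ?_⟩
    · rw [KacThermostat.gapFunction_eq_quadraticFun]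
      exact KacThermostat.memLp_quadraticFun hβ _
    · simpa using KacThermostat.generator_gapFunction hβ hN lam μ 1
  · rw [KacThermostat.gammaInner_eq hβ]
    simp only [mul_one]
    rw [KacThermostat.gapFunction_eq_quadraticFun, KacThermostat.integral_quadraticFun hβ]
  · intro hlam' hμ' h hE
    rw [KacThermostat.IsEigenfunction, KacThermostat.gammaMeasure_eq_pi N hβ] at hE
    rw [KacThermostat.gammaMeasure_eq_pi N hβ]
    exact KacThermostat.eigenfunction_unique hβ hN hlam' hμ' hE.1 hE.2.2
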